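/- A weighted graph $G$ on a vertex set $V$ is given by symmetric edge weights $w(x,y)\ge 0$ ($x,y\in V$, $w(x,y)=0$ meaning that there is no edge) such that $w_x:=\sum_y w(x,y)\in(0,\infty)$ for every vertex $x$; the graph may be infinite and may have loops. For a vertex set $z$ put $w_z:=\sum_{x\in z}w_x$. The random walk on $G$ moves from $x$ to $y$ with probability $w(x,y)/w_x$, and $T_{oz}\in\{0,1,2,\dots,\infty\}$ denotes the first time that the walk started at the vertex $o$ at time $0$ visits $z$. Let $\mathrm{dist}(o,z)\in\{0,1,\dots,\infty\}$ be the graph distance. For $g>1$ let $T'$ be the time at which the biased simple random walk on $\mathbb Z$, with odds $1$ and $g$ of going left and right, started at $0$, first hits $1$ (it is the random walk on the weighted graph $\mathbb Z$ with weight $g^k$ on the edge $\{k,k+1\}$). Let $m_g:=\mathbf E\,T'$ be its mean and let $I_g(a):=\sup_{\lambda\in\mathbb R}\big(\lambda a-\log \mathbf E\,e^{\lambda T'}\big)$ be its large deviation rate function. **Corollary (Large deviations for walks in graphs).** Let $C,g>1$. As $n\to\infty$, $$\inf_G \mathbf E\,T_{oz}=m_g n+O(1),$$ and for every $a$ with $1<a<m_g$,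 $$\sup_G \mathbf P[T_{oz}\le an]=e^{-I_g(a)n+o(n)},$$ where for each integer $n\ge 0$ the infimum and the supremum are over all weighted graphs $G$ with a vertex $o$ and a vertex set $z$ satisfying $\mathrm{dist}(o,z)\ge n$ and $w_z/w_o\le C g^n$. The function $O(1)$ depends on $n,C,g$ only, and the function $o(n)$ depends on $n,C,g,a$ only. -/

import Mathlib

open MeasureTheory ProbabilityTheory Filter Asymptotics
open scoped ENNReal

universe u

noncomputable section

/-- A weighted graph on the vertex set `V`, given by its symmetric edge weights; `weight x y = 0`
means that there is no edge between `x` and `y`, and `weight x x` is the weight of a loop.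
Every vertex has positive and finite total weight, so that the random walk is defined. -/
structure WeightedGraph (V : Type u) where
  weight : V → V → ℝ≥0∞
  symm : ∀ x y, weight x y = weight y x
  total_ne_zero : ∀ x, ∑' y, weight x y ≠ 0
  total_ne_top : ∀ x, ∑' y, weight x y ≠ ∞

namespace WeightedGraph

variable {V : Type u}

/-- The weight `w_x` of a vertex: the sum of the weights of the incident edges. -/
def vertexWeight (G : WeightedGraph V) (x : V) : ℝ≥0∞ := ∑' y, G.weight x y

/-- The weight `w_z` of a set of vertices: the sum of the weights of its vertices. -/
def setWeight (G : WeightedGraph V) (z : Set V) : ℝ≥0∞ := ∑' x : z, G.vertexWeight x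

/-- The graph formed by the edges of positive weight. -/
def toSimpleGraph (G : WeightedGraph V) : SimpleGraph V where
  Adj x y := x ≠ y ∧ G.weight x y ≠ 0
  symm := ⟨fun x y h => ⟨h.1.symm, by rw [G.symm y x]; exact h.2⟩⟩
  loopless := ⟨fun _ h => h.1 rfl⟩

/-- The graph distance from a vertex to a set of vertices (`⊤` if no vertex of the set can be
reached). -/
def distToSet (G : WeightedGraph V) (o : V) (z : Set V) : ℕ∞ :=
  ⨅ x ∈ z, G.toSimpleGraph.edist o x

/-- One step of the random walk from `x`: it goes to `y` with probability
`weight x y / vertexWeight x`. -/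
def step (G : WeightedGraph V) (x : V) : PMF V :=
  PMF.normalize (G.weight x) (G.total_ne_zero x) (G.total_ne_top x)

/-- The transition kernel of the random walk. -/
def stepKernel [MeasurableSpace V] [DiscreteMeasurableSpace V] (G : WeightedGraph V) :
    Kernel V V where
  toFun x := (G.step x).toMeasure
  measurable' := Measurable.of_discrete

instance [MeasurableSpace V] [DiscreteMeasurableSpace V] (G : WeightedGraph V) :
    IsMarkovKernel G.stepKernel :=
  ⟨fun x => inferInstanceAs (IsProbabilityMeasure (G.step x).toMeasure)⟩

/-- The law, on the space of trajectories `ℕ → V`, of the random walk started at `o` at time `0`. -/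
def walkLaw [MeasurableSpace V] [DiscreteMeasurableSpace V] (G : WeightedGraph V) (o : V) :
    Measure (ℕ → V) :=
  Kernel.traj (X := fun _ => V)
    (fun n => G.stepKernel.comap (fun p => p ⟨n, Finset.mem_Iic.2 le_rfl⟩)
      (measurable_pi_apply _)) 0 (fun _ => o)

/-- The first time at which a trajectory visits the set `z` (`⊤` if it never does). -/
def hitTime (z : Set V) (ω : ℕ → V) : ℕ∞ := ⨅ (k : ℕ) (_ : ω k ∈ z), (k : ℕ∞)

/-- The expected value of `F T`, with `T` the hitting time of `z` by the random walk started
at `o`. Vertex sets carry the discrete σ-algebra. -/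
def expectHit (G : WeightedGraph V) (o : V) (z : Set V) (F : ℕ∞ → ℝ≥0∞) : ℝ≥0∞ :=
  letI : MeasurableSpace V := ⊤
  haveI : DiscreteMeasurableSpace V := ⟨fun _ => trivial⟩
  ∫⁻ ω, F (hitTime z ω) ∂(G.walkLaw o)

/-- `E T`, with `T` the hitting time of `z` by the random walk started at `o`. -/
def meanHit (G : WeightedGraph V) (o : V) (z : Set V) : ℝ≥0∞ :=
  G.expectHit o z fun t => (t : ℝ≥0∞)

/-- `P[T ≤ t]`, with `T` the hitting time of `z` by the random walk started at `o`. -/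
def probHitLE (G : WeightedGraph V) (o : V) (z : Set V) (t : ℝ) : ℝ≥0∞ :=
  letI : MeasurableSpace V := ⊤
  haveI : DiscreteMeasurableSpace V := ⟨fun _ => trivial⟩
  G.walkLaw o {ω | (((hitTime z ω : ℕ∞) : ℝ≥0∞) : EReal) ≤ (t : EReal)}

/-- The constraints on the weighted graph, the starting vertex and the target set:
`n ≤ dist(o, z)` and `w_z / w_o ≤ C g ^ n`. -/
def Admissible (C g : ℝ) (n : ℕ) (G : WeightedGraph V) (o : V) (z : Set V) : Prop :=
  (n : ℕ∞) ≤ G.distToSet o z ∧ G.setWeight z / G.vertexWeight o ≤ ENNReal.ofReal (C * g ^ n)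

/-- The infimum of `E T` over all weighted graphs satisfying the constraints. -/
def infMeanHit (C g : ℝ) (n : ℕ) : ℝ≥0∞ :=
  ⨅ (V : Type u) (G : WeightedGraph V) (o : V) (z : Set V) (_ : Admissible C g n G o z),
    G.meanHit o z

/-- The supremum of `P[T ≤ t]` over all weighted graphs satisfying the constraints. -/
def supProbHitLE (C g : ℝ) (n : ℕ) (t : ℝ) : ℝ≥0∞ :=
  ⨆ (V : Type u) (G : WeightedGraph V) (o : V) (z : Set V) (_ : Admissible C g n G o z),
    G.probHitLE o z t

end WeightedGraph

/-- Edge weights of the biased walk on the integers: `g ^ k` on the edge `{k, k + 1}`. -/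
def biasedWeight (g : ℝ) (i j : ℤ) : ℝ≥0∞ :=
  if j = i + 1 then ENNReal.ofReal (g ^ i) else if i = j + 1 then ENNReal.ofReal (g ^ j) else 0

/-- The integers with weight `g ^ k` on the edge `{k, k + 1}`; its random walk is the biased simple
random walk with odds `1` and `g` of going left and right. -/
def biasedLine (g : ℝ) (hg : 1 < g) : WeightedGraph ℤ where
  weight := biasedWeight g
  symm i j := by
    unfold biasedWeight
    split_ifs <;> first | rfl | omega
  total_ne_zero i := by
    have h : biasedWeight g i (i + 1) ≠ 0 := by
      simp only [biasedWeight, if_true]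
      exact (ENNReal.ofReal_pos.2 (zpow_pos (by linarith) _)).ne'
    exact fun h0 => h (ENNReal.tsum_eq_zero.1 h0 _)
  total_ne_top i := by
    rw [tsum_eq_sum (s := {i - 1, i + 1})]
    · refine (ENNReal.sum_lt_top.2 fun j _ => ?_).ne
      unfold biasedWeight
      split_ifs <;> simp
    · intro j hj
      simp only [Finset.mem_insert, Finset.mem_singleton, not_or] at hj
      unfold biasedWeight
      rw [if_neg hj.2, if_neg (by omega)]

/-- `m_g`: the mean of the time `T'` at which the biased walk started at `0` hits `1`. -/
def biasedMean (g : ℝ) (hg : 1 < g) : ℝ :=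
  ((biasedLine g hg).meanHit 0 {1}).toReal

/-- `log E exp(l T')`, with values in `[-∞, ∞]`. -/
def biasedLogMGF (g : ℝ) (hg : 1 < g) (l : ℝ) : EReal :=
  ENNReal.log ((biasedLine g hg).expectHit 0 {1} fun t =>
    EReal.exp ((l : EReal) * ((t : ℝ≥0∞) : EReal)))

/-- `I_g(a)`: the large deviation rate function of `T'`, that is, the Legendre transform
`sup_l (l a - log E exp(l T'))` over all real `l`. -/
def biasedRate (g : ℝ) (hg : 1 < g) (a : ℝ) : ℝ :=
  (⨆ l : ℝ, ((l * a : ℝ) : EReal) - biasedLogMGF g hg l).toReal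

end

/-!
Let `F s = E_o s ^ T`, let `u x = E_x s ^ T`, and let `v` be the voltage from `o` of the walk
discounted by `s` and killed on `z`. By reversibility, `f x y = s * w x y * v x * u y` is a flow
carrying `F s` from `o` to `z`, with total mass `dF / d log s`. Test it against the potential
`M * dist(·, z) - c * log (v / u)`, clamped between `0` and its value at `o`, where `M` and `c` are
the intercept and the slope of a tangent line of the slowness as a function of the logarithm of the
bias. On each edge the required inequality is the tangent-line inequality, and the outcome is
`(log F)' ≥ slowness (g * F ^ (-2 / n)) * (n - O(1))`. The biased walk on `ℤ` satisfies this
differential inequality with equality, so comparison bounds `F`; the mean follows as `s → 1` and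
the probabilities by Chernoff's bound. The matching bounds come from the biased line itself: a
linear supersolution for the mean, and binomial path counting for the probability.
-/

noncomputable section

namespace WeightedGraph

variable {V : Type u}

section WalkLaw

variable [MeasurableSpace V] [DiscreteMeasurableSpace V] (G : WeightedGraph V) (o : V)

/-- The transition kernel of the walk as a function of its whole history up to time `n`, the form
in which `Kernel.traj` expects it. -/
def historyKernel (n : ℕ) : Kernel (Finset.Iic n → V) V :=
  G.stepKernel.comap (fun p => p ⟨n, Finset.mem_Iic.2 le_rfl⟩) (measurable_pi_apply _)

instance (n : ℕ) : IsMarkovKernel (G.historyKernel n) := by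
  unfold historyKernel
  infer_instance

instance : IsProbabilityMeasure (G.walkLaw o) :=
  inferInstanceAs (IsProbabilityMeasure (Kernel.traj (X := fun _ => V) G.historyKernel 0 _))

lemma lintegral_toMeasure_step (x : V) (f : V → ℝ≥0∞) :
    ∫⁻ y, f y ∂(G.step x).toMeasure = ∑' y, G.step x y * f y := by
  have toMeasure_eq_sum :
      (G.step x).toMeasure = Measure.sum fun y => G.step x y • Measure.dirac y := by
    ext s hs
    rw [PMF.toMeasure_apply _ hs, Measure.sum_apply _ hs]
    refine tsum_congr fun y => ?_
    by_cases hy : y ∈ s <;> simp [hs, hy]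
  simp_rw [toMeasure_eq_sum, lintegral_sum_measure, lintegral_smul_measure, lintegral_dirac,
    smul_eq_mul]

lemma lintegral_walkLaw_frestrictLe (k : ℕ) {h : (Finset.Iic k → V) → ℝ≥0∞} (hh : Measurable h) :
    ∫⁻ ω, h (Preorder.frestrictLe k ω) ∂G.walkLaw o =
      ∫⁻ p, h p ∂Kernel.partialTraj (X := fun _ => V) G.historyKernel 0 k (fun _ => o) := by
  rw [← Kernel.traj_map_frestrictLe_apply, lintegral_map hh (by fun_prop)]
  rfl

lemma lintegral_walkLaw_zero (f : V → ℝ≥0∞) : ∫⁻ ω, f (ω 0) ∂G.walkLaw o = f o := by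
  have hf : Measurable fun p : Finset.Iic 0 → V => f (p ⟨0, Finset.mem_Iic.2 le_rfl⟩) :=
    (Measurable.of_discrete (f := f)).comp (measurable_pi_apply _)
  refine (G.lintegral_walkLaw_frestrictLe o 0 hf).trans ?_
  rw [Kernel.partialTraj_self, Kernel.id_apply, lintegral_dirac' _ hf]

lemma lintegral_partialTraj_succ (k : ℕ) {h : (Finset.Iic k → V) → ℝ≥0∞} (hh : Measurable h)
    (f : V → ℝ≥0∞) (x : Finset.Iic 0 → V) :
    ∫⁻ p, h (Preorder.frestrictLe₂ (π := fun _ => V) k.le_succ p) *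
        f (p ⟨k + 1, Finset.mem_Iic.2 le_rfl⟩)
        ∂Kernel.partialTraj (X := fun _ => V) G.historyKernel 0 (k + 1) x =
      ∫⁻ p, h p * ∑' y, G.step (p ⟨k, Finset.mem_Iic.2 le_rfl⟩) y * f y
        ∂Kernel.partialTraj (X := fun _ => V) G.historyKernel 0 k x := by
  have hf : Measurable f := .of_discrete
  have hglue : Measurable (IicProdIoc (X := fun _ => V) k (k + 1)) := measurable_IicProdIoc
  have hint : Measurable fun p : Finset.Iic (k + 1) → V =>
      h (Preorder.frestrictLe₂ (π := fun _ => V) k.le_succ p) *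
        f (p ⟨k + 1, Finset.mem_Iic.2 le_rfl⟩) :=
    (hh.comp (Preorder.measurable_frestrictLe₂ _)).mul (hf.comp (measurable_pi_apply _))
  have hint_glue : Measurable fun q : (Finset.Iic k → V) × (Finset.Ioc k (k + 1) → V) =>
      h (Preorder.frestrictLe₂ (π := fun _ => V) k.le_succ
          (IicProdIoc (X := fun _ => V) k (k + 1) q)) *
        f (IicProdIoc (X := fun _ => V) k (k + 1) q ⟨k + 1, Finset.mem_Iic.2 le_rfl⟩) :=
    hint.comp hglue
  have integrand_glue (p : Finset.Iic k → V) (c : Finset.Ioc k (k + 1) → V) :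
      h (Preorder.frestrictLe₂ (π := fun _ => V) k.le_succ
          (IicProdIoc (X := fun _ => V) k (k + 1) (p, c))) *
        f (IicProdIoc (X := fun _ => V) k (k + 1) (p, c) ⟨k + 1, Finset.mem_Iic.2 le_rfl⟩) =
      h p * f (c ⟨k + 1, by simp⟩) := by
    rw [show Preorder.frestrictLe₂ (π := fun _ => V) k.le_succ
          (IicProdIoc (X := fun _ => V) k (k + 1) (p, c)) = p from
        congrFun (frestrictLe₂_comp_IicProdIoc (X := fun _ => V) k.le_succ) (p, c)]
    simp [IicProdIoc]
  rw [Kernel.partialTraj_succ_of_le k.zero_le, Kernel.lintegral_map _ hglue _ hint,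
    Kernel.lintegral_comp _ _ _ hint_glue]
  refine lintegral_congr fun p => ?_
  simp_rw [Kernel.lintegral_id_prod hint_glue, integrand_glue]
  have hlast : Measurable fun c : Finset.Ioc k (k + 1) → V => f (c ⟨k + 1, by simp⟩) :=
    hf.comp (by fun_prop)
  rw [lintegral_const_mul _ hlast, Kernel.lintegral_map _ (by fun_prop) _ hlast]
  exact congrArg (h p * ·) (G.lintegral_toMeasure_step _ _)

lemma lintegral_walkLaw_succ (k : ℕ) {h : (Finset.Iic k → V) → ℝ≥0∞} (hh : Measurable h)
    (f : V → ℝ≥0∞) :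
    ∫⁻ ω, h (Preorder.frestrictLe k ω) * f (ω (k + 1)) ∂G.walkLaw o =
      ∫⁻ ω, h (Preorder.frestrictLe k ω) * ∑' y, G.step (ω k) y * f y ∂G.walkLaw o := by
  have hf : Measurable f := .of_discrete
  have hPf : Measurable fun x => ∑' y, G.step x y * f y := .of_discrete
  exact (G.lintegral_walkLaw_frestrictLe o (k + 1)
      ((hh.comp (Preorder.measurable_frestrictLe₂ _)).mul (hf.comp (measurable_pi_apply _)))).trans
    ((G.lintegral_partialTraj_succ k hh f _).trans
      (G.lintegral_walkLaw_frestrictLe o k (hh.mul (hPf.comp (measurable_pi_apply _)))).symm)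

end WalkLaw

/-- The transition operator of the walk killed on entering `z`. -/
def killed (G : WeightedGraph V) (z : Set V) (f : V → ℝ≥0∞) (x : V) : ℝ≥0∞ :=
  ∑' y, G.step x y * zᶜ.indicator f y

/-- The probability of entering `z` in the next step. -/
def enter (G : WeightedGraph V) (z : Set V) (x : V) : ℝ≥0∞ :=
  ∑' y, G.step x y * z.indicator 1 y

/-- The event that the walk avoids `z` up to time `k`. -/
def avoids (z : Set V) (k : ℕ) : Set (ℕ → V) := {ω | ∀ j ≤ k, ω j ∉ z}

lemma avoids_eq_preimage (z : Set V) (k : ℕ) :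
    avoids z k = Preorder.frestrictLe k ⁻¹' Set.univ.pi fun _ : Finset.Iic k => zᶜ := by
  ext ω
  simp [avoids]

lemma mem_avoids_succ {z : Set V} {k : ℕ} {ω : ℕ → V} :
    ω ∈ avoids z (k + 1) ↔ ω ∈ avoids z k ∧ ω (k + 1) ∉ z := by
  simp only [avoids, Set.mem_ofPred_eq, Nat.le_succ_iff, or_imp, forall_and, forall_eq]

lemma hitTime_le_iff (z : Set V) (ω : ℕ → V) (k : ℕ) : hitTime z ω ≤ k ↔ ω ∉ avoids z k := by
  simp only [avoids, Set.mem_ofPred_eq, not_forall, not_not, exists_prop]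
  constructor
  · intro h
    by_contra! hk
    have : ((k + 1 : ℕ) : ℕ∞) ≤ hitTime z ω :=
      le_iInf₂ fun j hj => Nat.cast_le.2 (Nat.succ_le_of_lt (lt_of_not_ge fun hjk => hk j hjk hj))
    exact absurd (Nat.cast_le.1 (this.trans h)) (Nat.not_succ_le_self k)
  · rintro ⟨j, hj, hz⟩
    exact (iInf₂_le j hz).trans (Nat.cast_le.2 hj)

lemma mem_avoids_iff {z : Set V} {ω : ℕ → V} {k : ℕ} : ω ∈ avoids z k ↔ (k : ℕ∞) < hitTime z ω := by
  rw [← not_le, hitTime_le_iff, not_not]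

lemma setOf_hitTime_eq_top (z : Set V) : {ω | hitTime z ω = ⊤} = ⋂ k, avoids z k := by
  ext ω
  simp [mem_avoids_iff, ENat.eq_top_iff_forall_gt]

lemma setOf_hitTime_eq_zero (z : Set V) : {ω | hitTime z ω = 0} = (avoids z 0)ᶜ := by
  ext ω
  simp [mem_avoids_iff]

lemma setOf_hitTime_eq_succ (z : Set V) (k : ℕ) :
    {ω | hitTime z ω = (k + 1 : ℕ)} = avoids z k \ avoids z (k + 1) := by
  ext ω
  simp only [Set.mem_ofPred_eq, Set.mem_sdiff, mem_avoids_iff]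
  induction hitTime z ω using ENat.recTopCoe with
  | top => simpa using (ENat.natCast_ne_top (k + 1)).symm
  | coe j =>
    norm_cast
    omega

section Events

variable [MeasurableSpace V] [DiscreteMeasurableSpace V]

lemma measurableSet_avoids (z : Set V) (k : ℕ) : MeasurableSet (avoids z k) := by
  rw [avoids_eq_preimage]
  exact Preorder.measurable_frestrictLe k (MeasurableSet.univ_pi fun _ => .of_discrete)

lemma measurable_hitTime (z : Set V) : Measurable (hitTime z) := by
  refine measurable_to_countable' fun t => ?_
  change MeasurableSet {ω | hitTime z ω = t}
  induction t using ENat.recTopCoe with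
  | top =>
    rw [setOf_hitTime_eq_top]
    exact .iInter fun k => measurableSet_avoids z k
  | coe k =>
    cases k with
    | zero =>
      rw [Nat.cast_zero, setOf_hitTime_eq_zero]
      exact (measurableSet_avoids z 0).compl
    | succ k =>
      rw [setOf_hitTime_eq_succ]
      exact (measurableSet_avoids z k).diff (measurableSet_avoids z (k + 1))

lemma lintegral_avoids (G : WeightedGraph V) {z : Set V} {o : V} (ho : o ∉ z) (k : ℕ)
    (f : V → ℝ≥0∞) :
    ∫⁻ ω, (avoids z k).indicator 1 ω * f (ω k) ∂G.walkLaw o = (G.killed z)^[k] f o := by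
  induction k generalizing f with
  | zero =>
    have (ω : ℕ → V) : (avoids z 0).indicator 1 ω * f (ω 0) = zᶜ.indicator f (ω 0) := by
      by_cases h : ω 0 ∈ z <;> simp [avoids, h, Set.indicator]
    simp_rw [this, lintegral_walkLaw_zero]
    simp [ho]
  | succ k ih =>
    let A : Set (Finset.Iic k → V) := Set.univ.pi fun _ => zᶜ
    have indicator_avoids (ω : ℕ → V) : (avoids z k).indicator (1 : (ℕ → V) → ℝ≥0∞) ω =
        A.indicator 1 (Preorder.frestrictLe k ω) := by
      rw [avoids_eq_preimage]
      rfl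
    have indicator_avoids_succ (ω : ℕ → V) : (avoids z (k + 1)).indicator 1 ω * f (ω (k + 1)) =
        A.indicator 1 (Preorder.frestrictLe k ω) * zᶜ.indicator f (ω (k + 1)) := by
      rw [← indicator_avoids]
      by_cases h₁ : ω ∈ avoids z k <;> by_cases h₂ : ω (k + 1) ∈ z <;>
        simp [Set.indicator, mem_avoids_succ, h₁, h₂]
    simp_rw [indicator_avoids_succ]
    rw [lintegral_walkLaw_succ _ _ _
      (measurable_one.indicator (MeasurableSet.univ_pi fun _ => .of_discrete)),
      Function.iterate_succ_apply, ← ih]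
    simp_rw [indicator_avoids]
    rfl

end Events

section Killed

variable (G : WeightedGraph V) (z : Set V)

/-- The probability that the walk started at `x ∉ z` hits `z` at time `k + 1`. -/
def hitProb (k : ℕ) (x : V) : ℝ≥0∞ := (G.killed z)^[k] (G.enter z) x

/-- The probability that the walk started at `x ∉ z` never hits `z`. -/
def missProb (x : V) : ℝ≥0∞ := 1 - ∑' k, G.hitProb z k x

lemma killed_one_add_enter : G.killed z 1 + G.enter z = 1 := by
  ext x
  rw [Pi.add_apply, killed, enter, ← ENNReal.tsum_add, Pi.one_apply, ← (G.step x).tsum_coe]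
  refine tsum_congr fun y => ?_
  by_cases h : y ∈ z <;> simp [h]

lemma killed_add (f h : V → ℝ≥0∞) : G.killed z (f + h) = G.killed z f + G.killed z h := by
  ext x
  simp only [killed, Pi.add_apply, ← ENNReal.tsum_add, Set.indicator_add', mul_add]

lemma killed_const_mul (c : ℝ≥0∞) (f : V → ℝ≥0∞) :
    G.killed z (fun y => c * f y) = fun x => c * G.killed z f x := by
  ext x
  simp only [killed, ← ENNReal.tsum_mul_left]
  refine tsum_congr fun y => ?_
  by_cases h : y ∈ z <;> simp [h, mul_left_comm]

lemma killed_tsum {ι : Type*} (f : ι → V → ℝ≥0∞) :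
    G.killed z (fun y => ∑' i, f i y) = fun x => ∑' i, G.killed z (f i) x := by
  ext x
  simp only [killed]
  rw [ENNReal.tsum_comm]
  refine tsum_congr fun y => ?_
  by_cases h : y ∈ z <;> simp [h, ENNReal.tsum_mul_left]

lemma monotone_killed : Monotone (G.killed z) := fun _ _ hfh _ =>
  ENNReal.tsum_le_tsum fun y => mul_le_mul_right (Set.indicator_le_indicator (hfh y)) _

lemma killed_iterate_add (f h : V → ℝ≥0∞) (k : ℕ) :
    (G.killed z)^[k] (f + h) = (G.killed z)^[k] f + (G.killed z)^[k] h := by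
  induction k generalizing f h with
  | zero => rfl
  | succ k ih => simp only [Function.iterate_succ_apply, killed_add, ih]

lemma killed_iterate_const_mul (c : ℝ≥0∞) (f : V → ℝ≥0∞) (k : ℕ) :
    (G.killed z)^[k] (fun y => c * f y) = fun x => c * (G.killed z)^[k] f x := by
  induction k generalizing f with
  | zero => rfl
  | succ k ih => simp only [Function.iterate_succ_apply, killed_const_mul, ih]

lemma killed_iterate_tsum {ι : Type*} (f : ι → V → ℝ≥0∞) (k : ℕ) :
    (G.killed z)^[k] (fun y => ∑' i, f i y) = fun x => ∑' i, (G.killed z)^[k] (f i) x := by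
  induction k generalizing f with
  | zero => rfl
  | succ k ih => simp only [Function.iterate_succ_apply, killed_tsum, ih]

lemma killed_iterate_one_eq (k : ℕ) (x : V) :
    (G.killed z)^[k] 1 x = (G.killed z)^[k + 1] 1 x + G.hitProb z k x := by
  rw [Function.iterate_succ_apply, hitProb, ← Pi.add_apply ((G.killed z)^[k] _),
    ← killed_iterate_add, killed_one_add_enter]

lemma sum_hitProb_add_killed_iterate_one (k : ℕ) (x : V) :
    ∑ j ∈ Finset.range k, G.hitProb z j x + (G.killed z)^[k] 1 x = 1 := by
  induction k with
  | zero => simp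
  | succ k ih =>
    rw [Finset.sum_range_succ, add_assoc, add_comm (G.hitProb z k x), ← killed_iterate_one_eq, ih]

lemma killed_iterate_one_le_one (k : ℕ) (x : V) : (G.killed z)^[k] 1 x ≤ 1 :=
  le_add_self.trans (G.sum_hitProb_add_killed_iterate_one z k x).le

lemma tsum_hitProb_le_one (x : V) : ∑' k, G.hitProb z k x ≤ 1 := by
  rw [ENNReal.tsum_eq_iSup_nat]
  exact iSup_le fun k => le_self_add.trans (sum_hitProb_add_killed_iterate_one G z k x).le

lemma tsum_hitProb_ne_top (x : V) : ∑' k, G.hitProb z k x ≠ ∞ :=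
  ne_top_of_le_ne_top ENNReal.one_ne_top (G.tsum_hitProb_le_one z x)

lemma hitProb_le_one (k : ℕ) (x : V) : G.hitProb z k x ≤ 1 :=
  (ENNReal.le_tsum k).trans (G.tsum_hitProb_le_one z x)

lemma hitProb_ne_top (k : ℕ) (x : V) : G.hitProb z k x ≠ ∞ :=
  ne_top_of_le_ne_top ENNReal.one_ne_top (G.hitProb_le_one z k x)

end Killed

section HittingTime

variable (G : WeightedGraph V) {z : Set V} {o : V}

section

variable [MeasurableSpace V] [DiscreteMeasurableSpace V]

lemma walkLaw_avoids (ho : o ∉ z) (k : ℕ) :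
    G.walkLaw o (avoids z k) = (G.killed z)^[k] 1 o := by
  rw [← lintegral_avoids G ho, ← lintegral_indicator_one (measurableSet_avoids z k)]
  simp

lemma walkLaw_hitTime_eq_zero (ho : o ∉ z) : G.walkLaw o {ω | hitTime z ω = 0} = 0 := by
  rw [setOf_hitTime_eq_zero, prob_compl_eq_zero_iff (measurableSet_avoids z 0),
    walkLaw_avoids G ho, Function.iterate_zero_apply, Pi.one_apply]

lemma walkLaw_hitTime_eq_succ (ho : o ∉ z) (k : ℕ) :
    G.walkLaw o {ω | hitTime z ω = (k + 1 : ℕ)} = G.hitProb z k o := by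
  rw [setOf_hitTime_eq_succ, measure_sdiff (fun ω h => (mem_avoids_succ.1 h).1)
    (measurableSet_avoids z _).nullMeasurableSet (measure_ne_top _ _), walkLaw_avoids G ho,
    walkLaw_avoids G ho, killed_iterate_one_eq G z k o]
  exact ENNReal.add_sub_cancel_left (walkLaw_avoids G ho (k + 1) ▸ measure_ne_top _ _)

lemma lintegral_comp_hitTime (o : V) (F : ℕ∞ → ℝ≥0∞) :
    ∫⁻ ω, F (hitTime z ω) ∂G.walkLaw o = F ⊤ * G.walkLaw o {ω | hitTime z ω = ⊤} +
      ∑' k : ℕ, F k * G.walkLaw o {ω | hitTime z ω = k} := by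
  have measurableSet_eq (t : ℕ∞) : MeasurableSet {ω : ℕ → V | hitTime z ω = t} :=
    measurable_hitTime z (measurableSet_singleton t)
  have decompose (ω : ℕ → V) : F (hitTime z ω) =
      {ω | hitTime z ω = ⊤}.indicator (fun _ => F ⊤) ω +
        ∑' k : ℕ, {ω | hitTime z ω = k}.indicator (fun _ => F k) ω := by
    simp only [Set.indicator, Set.mem_ofPred_eq]
    induction hitTime z ω using ENat.recTopCoe with
    | top => simp
    | coe j =>
      rw [tsum_eq_single j fun i hi => if_neg (by exact_mod_cast hi.symm)]
      simp
  simp_rw [decompose]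
  rw [lintegral_add_left (measurable_const.indicator (measurableSet_eq _)),
    lintegral_tsum fun k => (measurable_const.indicator (measurableSet_eq _)).aemeasurable]
  simp_rw [lintegral_indicator_const (measurableSet_eq _)]

lemma walkLaw_hitTime_eq_top (ho : o ∉ z) :
    G.walkLaw o {ω | hitTime z ω = ⊤} = G.missProb z o := by
  have total := G.lintegral_comp_hitTime (z := z) o 1
  rw [tsum_eq_zero_add' ENNReal.summable] at total
  simp only [Pi.one_apply, lintegral_const, measure_univ, one_mul, Nat.cast_zero,
    walkLaw_hitTime_eq_zero G ho, walkLaw_hitTime_eq_succ G ho, zero_add] at total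
  rw [missProb, total, ENNReal.add_sub_cancel_right (G.tsum_hitProb_ne_top z o)]

end

lemma expectHit_eq (ho : o ∉ z) (F : ℕ∞ → ℝ≥0∞) :
    G.expectHit o z F = F ⊤ * G.missProb z o + ∑' k : ℕ, F (k + 1 : ℕ) * G.hitProb z k o := by
  let _ : MeasurableSpace V := ⊤
  have : DiscreteMeasurableSpace V := ⟨fun _ => trivial⟩
  unfold expectHit
  rw [lintegral_comp_hitTime, tsum_eq_zero_add' ENNReal.summable]
  simp only [Nat.cast_zero, walkLaw_hitTime_eq_zero G ho, walkLaw_hitTime_eq_succ G ho, zero_add,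
    walkLaw_hitTime_eq_top G ho, mul_zero]

lemma coe_toENNReal_le_coe_iff (T : ℕ∞) {t : ℝ} (ht : 0 ≤ t) :
    ((T : ℝ≥0∞) : EReal) ≤ (t : EReal) ↔ T ≤ (⌊t⌋₊ : ℕ∞) := by
  induction T using ENat.recTopCoe with
  | top => simp
  | coe j =>
    rw [Nat.cast_le, Nat.le_floor_iff ht, ENat.toENNReal_coe, ← ENNReal.ofReal_natCast,
      EReal.coe_ennreal_ofReal, max_eq_left (Nat.cast_nonneg j), EReal.coe_le_coe_iff]

lemma probHitLE_eq (ho : o ∉ z) {t : ℝ} (ht : 0 ≤ t) :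
    G.probHitLE o z t = ∑ k ∈ Finset.range ⌊t⌋₊, G.hitProb z k o := by
  let _ : MeasurableSpace V := ⊤
  have : DiscreteMeasurableSpace V := ⟨fun _ => trivial⟩
  have event_eq : {ω | (((hitTime z ω : ℕ∞) : ℝ≥0∞) : EReal) ≤ (t : EReal)} = (avoids z ⌊t⌋₊)ᶜ := by
    ext ω
    rw [Set.mem_compl_iff, ← hitTime_le_iff, Set.mem_ofPred_eq, coe_toENNReal_le_coe_iff _ ht]
  rw [probHitLE, event_eq, prob_compl_eq_one_sub (measurableSet_avoids z _), walkLaw_avoids G ho,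
    ← sum_hitProb_add_killed_iterate_one G z ⌊t⌋₊ o]
  exact ENNReal.add_sub_cancel_right (walkLaw_avoids G ho _ ▸ measure_ne_top _ _)

lemma toENNReal_hitTime_eq_tsum (z : Set V) (ω : ℕ → V) :
    ((hitTime z ω : ℕ∞) : ℝ≥0∞) = ∑' k : ℕ, (avoids z k).indicator 1 ω := by
  classical
  simp only [Set.indicator_apply, mem_avoids_iff, Pi.one_apply]
  induction hitTime z ω using ENat.recTopCoe with
  | top => simp
  | coe j =>
    rw [tsum_eq_sum (s := Finset.range j) fun k hk => if_neg (by simpa using hk),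
      Finset.sum_congr rfl fun k hk => if_pos (by simpa using hk)]
    simp

lemma meanHit_eq (ho : o ∉ z) : G.meanHit o z = ∑' k, (G.killed z)^[k] 1 o := by
  let _ : MeasurableSpace V := ⊤
  have : DiscreteMeasurableSpace V := ⟨fun _ => trivial⟩
  simp_rw [meanHit, expectHit, toENNReal_hitTime_eq_tsum,
    lintegral_tsum fun k => (measurable_one.indicator (measurableSet_avoids z k)).aemeasurable,
    lintegral_indicator_one (measurableSet_avoids z _), walkLaw_avoids G ho]

end HittingTime

section Reversibility

variable (G : WeightedGraph V) (z : Set V) (o : V)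

lemma vertexWeight_ne_zero (x : V) : G.vertexWeight x ≠ 0 := G.total_ne_zero x

lemma vertexWeight_ne_top (x : V) : G.vertexWeight x ≠ ∞ := G.total_ne_top x

lemma weight_le_vertexWeight (x y : V) : G.weight x y ≤ G.vertexWeight x := ENNReal.le_tsum y

lemma weight_ne_top (x y : V) : G.weight x y ≠ ∞ :=
  ne_top_of_le_ne_top (G.vertexWeight_ne_top x) (G.weight_le_vertexWeight x y)

lemma step_apply (x y : V) : G.step x y = G.weight x y * (G.vertexWeight x)⁻¹ :=
  PMF.normalize_apply ..

lemma vertexWeight_mul_step (x y : V) : G.vertexWeight x * G.step x y = G.weight x y := by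
  rw [step_apply, mul_left_comm,
    ENNReal.mul_inv_cancel (G.vertexWeight_ne_zero x) (G.vertexWeight_ne_top x), mul_one]

lemma tsum_vertexWeight_mul_killed (f h : V → ℝ≥0∞) :
    ∑' x, G.vertexWeight x * (zᶜ.indicator h x * G.killed z f x) =
      ∑' x, ∑' y, G.weight x y * (zᶜ.indicator h x * zᶜ.indicator f y) := by
  refine tsum_congr fun x => ?_
  simp_rw [killed, ← ENNReal.tsum_mul_left, ← vertexWeight_mul_step]
  exact tsum_congr fun y => by ring

lemma tsum_vertexWeight_mul_killed_comm (f h : V → ℝ≥0∞) :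
    ∑' x, G.vertexWeight x * (zᶜ.indicator h x * G.killed z f x) =
      ∑' x, G.vertexWeight x * (zᶜ.indicator f x * G.killed z h x) := by
  rw [tsum_vertexWeight_mul_killed, tsum_vertexWeight_mul_killed, ENNReal.tsum_comm]
  exact tsum_congr fun x => tsum_congr fun y => by
    rw [G.symm, mul_comm (zᶜ.indicator h y)]

lemma tsum_vertexWeight_mul_killed_iterate_comm (f h : V → ℝ≥0∞) (k : ℕ) :
    ∑' x, G.vertexWeight x * (zᶜ.indicator h x * (G.killed z)^[k] f x) =
      ∑' x, G.vertexWeight x * (zᶜ.indicator f x * (G.killed z)^[k] h x) := by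
  have indicator_mul_comm (a b : V → ℝ≥0∞) (x : V) :
      zᶜ.indicator a x * b x = zᶜ.indicator b x * a x := by
    by_cases hx : x ∈ z <;> simp [hx, mul_comm]
  induction k generalizing h with
  | zero => simp_rw [Function.iterate_zero_apply, indicator_mul_comm h]
  | succ k ih =>
    simp_rw [Function.iterate_succ_apply' _ k f, tsum_vertexWeight_mul_killed_comm G z _ h,
      indicator_mul_comm ((G.killed z)^[k] f), ih, Function.iterate_succ_apply]

/-- The discounted Green operator `∑ₖ sᵏ Pᵏ` of the walk killed on entering `z`. -/
def green (s : ℝ≥0∞) (f : V → ℝ≥0∞) (x : V) : ℝ≥0∞ := ∑' k, s ^ k * (G.killed z)^[k] f x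

lemma green_eq (s : ℝ≥0∞) (f : V → ℝ≥0∞) (x : V) :
    G.green z s f x = f x + s * G.killed z (G.green z s f) x := by
  unfold green
  simp_rw [killed_tsum, killed_const_mul]
  rw [tsum_eq_zero_add' ENNReal.summable, ← ENNReal.tsum_mul_left]
  simp only [Function.iterate_succ_apply', pow_succ', pow_zero, one_mul, Function.iterate_zero, id,
    mul_assoc]

lemma green_ne_top {s : ℝ≥0∞} (hs : s < 1) {f : V → ℝ≥0∞} (hf : f ≤ 1) (x : V) :
    G.green z s f x ≠ ∞ := by
  refine ne_top_of_le_ne_top (b := ∑' k, s ^ k) ?_ (ENNReal.tsum_le_tsum fun k =>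
    mul_le_of_le_one_right' (((G.monotone_killed z).iterate k hf x).trans
      (G.killed_iterate_one_le_one z k x)))
  rw [ENNReal.tsum_geometric]
  exact ENNReal.inv_ne_top.2 (tsub_pos_of_lt hs).ne'

lemma tsum_vertexWeight_mul_green_comm (s : ℝ≥0∞) (f h : V → ℝ≥0∞) :
    ∑' x, G.vertexWeight x * (zᶜ.indicator h x * G.green z s f x) =
      ∑' x, G.vertexWeight x * (zᶜ.indicator f x * G.green z s h x) := by
  have expand (a b : V → ℝ≥0∞) :
      ∑' x, G.vertexWeight x * (zᶜ.indicator a x * G.green z s b x) =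
        ∑' k, s ^ k * ∑' x, G.vertexWeight x * (zᶜ.indicator a x * (G.killed z)^[k] b x) := by
    simp_rw [green, ← ENNReal.tsum_mul_left]
    rw [ENNReal.tsum_comm]
    exact tsum_congr fun k => tsum_congr fun x => by ring
  simp_rw [expand, tsum_vertexWeight_mul_killed_iterate_comm G z f h]

/-- The generating function `E_x s^T` of the hitting time of `z`, for `x ∉ z`. -/
def hitGen (s : ℝ≥0∞) (x : V) : ℝ≥0∞ := ∑' k, s ^ (k + 1) * G.hitProb z k x

/-- The logarithmic derivative `s d/ds` of `hitGen`, that is, `E_x[T s^T]` for `x ∉ z`. -/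
def hitGenDeriv (s : ℝ≥0∞) (x : V) : ℝ≥0∞ := ∑' k : ℕ, (k + 1) * (s ^ (k + 1) * G.hitProb z k x)

open Classical in
/-- The function `x ↦ E_x s^T`, which is `1` on the target set `z`. -/
def discount (s : ℝ≥0∞) (x : V) : ℝ≥0∞ := if x ∈ z then 1 else G.hitGen z s x

/-- The voltage at `x` of the discounted unit current from `o` to `z`. -/
def voltage (s : ℝ≥0∞) : V → ℝ≥0∞ :=
  zᶜ.indicator fun x => G.green z s (({o} : Set V).indicator 1) x / G.vertexWeight o

variable {z} in
lemma discount_of_notMem {x : V} (hx : x ∉ z) (s : ℝ≥0∞) : G.discount z s x = G.hitGen z s x :=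
  if_neg hx

variable {z} in
lemma discount_of_mem {x : V} (hx : x ∈ z) (s : ℝ≥0∞) : G.discount z s x = 1 := if_pos hx

variable {z} in
lemma voltage_of_mem {x : V} (hx : x ∈ z) (s : ℝ≥0∞) : G.voltage z o s x = 0 :=
  Set.indicator_of_notMem (not_not.2 hx) _

lemma hitGen_eq_mul_green (s : ℝ≥0∞) : G.hitGen z s = fun x => s * G.green z s (G.enter z) x := by
  ext x
  simp_rw [hitGen, green, ← ENNReal.tsum_mul_left, pow_succ', mul_assoc, hitProb]

lemma hitGen_eq (s : ℝ≥0∞) (x : V) :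
    G.hitGen z s x = s * (G.enter z x + G.killed z (G.hitGen z s) x) := by
  rw [hitGen_eq_mul_green, killed_const_mul, ← green_eq]

lemma hitGenDeriv_eq_green (s : ℝ≥0∞) (x : V) :
    G.hitGenDeriv z s x = G.green z s (G.hitGen z s) x := by
  have hitProb_add (k j : ℕ) : (G.killed z)^[k] (G.hitProb z j) x = G.hitProb z (k + j) x :=
    (congrFun (Function.iterate_add_apply (G.killed z) k j (G.enter z)) x).symm
  have green_hitGen : G.green z s (G.hitGen z s) x =
      ∑' p : ℕ × ℕ, s ^ (p.1 + p.2 + 1) * G.hitProb z (p.1 + p.2) x := by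
    rw [ENNReal.tsum_prod (f := fun k j => s ^ (k + j + 1) * G.hitProb z (k + j) x)]
    refine tsum_congr fun k => ?_
    rw [show G.hitGen z s = fun y => ∑' j, s ^ (j + 1) * G.hitProb z j y from rfl,
      killed_iterate_tsum, ← ENNReal.tsum_mul_left]
    simp only [killed_iterate_const_mul, hitProb_add]
    exact tsum_congr fun j => by ring
  rw [green_hitGen, ← Finset.HasAntidiagonal.sigmaAntidiagonalEquivProd.tsum_eq,
    ENNReal.tsum_sigma']
  refine tsum_congr fun m => ?_
  rw [tsum_congr (g := fun _ => s ^ (m + 1) * G.hitProb z m x), tsum_fintype]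
  · simp
  · rintro ⟨⟨a, b⟩, hab⟩
    obtain rfl : a + b = m := by simpa using hab
    rfl

variable {z} in
lemma vertexWeight_mul_discount {x : V} (hx : x ∉ z) (s : ℝ≥0∞) :
    G.vertexWeight x * G.discount z s x = s * ∑' y, G.weight x y * G.discount z s y := by
  rw [discount_of_notMem G hx, hitGen_eq, enter, killed, ← ENNReal.tsum_add, mul_left_comm,
    ← ENNReal.tsum_mul_left]
  congr 1
  refine tsum_congr fun y => ?_
  rw [← vertexWeight_mul_step, mul_assoc]
  by_cases hy : y ∈ z <;> simp [hy, discount]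

variable {z} in
lemma vertexWeight_mul_voltage {x : V} (hx : x ∉ z) (s : ℝ≥0∞) :
    G.vertexWeight x * G.voltage z o s x =
      ({o} : Set V).indicator 1 x + s * ∑' y, G.weight x y * G.voltage z o s y := by
  set δ : V → ℝ≥0∞ := ({o} : Set V).indicator 1
  have voltage_apply (y : V) :
      G.voltage z o s y = zᶜ.indicator (G.green z s δ) y * (G.vertexWeight o)⁻¹ := by
    by_cases hy : y ∈ z <;> simp [voltage, hy, div_eq_mul_inv, δ]
  simp_rw [voltage_apply, ← vertexWeight_mul_step, mul_assoc]
  rw [Set.indicator_of_mem (show x ∈ zᶜ from hx), green_eq, killed, ENNReal.tsum_mul_left,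
    add_mul, mul_add]
  congr 1
  · by_cases hxo : x = o
    · simp [δ, hxo, ENNReal.mul_inv_cancel (G.vertexWeight_ne_zero o) (G.vertexWeight_ne_top o)]
    · simp [δ, hxo]
  · simp_rw [← mul_assoc, ENNReal.tsum_mul_right]
    ring

lemma hitGen_le_one {s : ℝ≥0∞} (hs : s ≤ 1) (x : V) : G.hitGen z s x ≤ 1 :=
  (ENNReal.tsum_le_tsum fun _ => mul_le_of_le_one_left' (pow_le_one' hs _)).trans
    (G.tsum_hitProb_le_one z x)

lemma discount_le_one {s : ℝ≥0∞} (hs : s ≤ 1) (x : V) : G.discount z s x ≤ 1 := by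
  rw [discount]
  split_ifs
  exacts [le_rfl, G.hitGen_le_one z hs x]

lemma voltage_ne_top {s : ℝ≥0∞} (hs : s < 1) (x : V) : G.voltage z o s x ≠ ∞ := by
  by_cases hx : x ∈ z
  · simp [voltage_of_mem G o hx]
  · rw [voltage, Set.indicator_of_mem (show x ∈ zᶜ from hx)]
    exact ENNReal.div_ne_top (G.green_ne_top z hs (Set.indicator_le_self' fun _ _ => zero_le_one) x)
      (G.vertexWeight_ne_zero o)

lemma hitGenDeriv_ne_top {s : ℝ≥0∞} (hs : s < 1) (x : V) : G.hitGenDeriv z s x ≠ ∞ := by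
  rw [hitGenDeriv_eq_green]
  exact G.green_ne_top z hs (G.hitGen_le_one z hs.le) x

/-- The discounted flow of the conditioned walk along the directed edge from `x` to `y`. -/
def flow (s : ℝ≥0∞) (x y : V) : ℝ≥0∞ :=
  s * G.weight x y * G.voltage z o s x * G.discount z s y

lemma tsum_flow_left (s : ℝ≥0∞) (x : V) :
    ∑' y, G.flow z o s x y = G.vertexWeight x * G.voltage z o s x * G.discount z s x := by
  by_cases hx : x ∈ z
  · simp [flow, voltage_of_mem G o hx]
  · rw [mul_right_comm, vertexWeight_mul_discount G hx, mul_right_comm, ← ENNReal.tsum_mul_left]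
    exact tsum_congr fun y => by rw [flow]; ring

variable {z} in
lemma tsum_flow_right (s : ℝ≥0∞) {y : V} (hy : y ∉ z) :
    ∑' x, G.flow z o s x y + ({o} : Set V).indicator (G.hitGen z s) y =
      G.vertexWeight y * G.voltage z o s y * G.discount z s y := by
  rw [vertexWeight_mul_voltage G o hy, add_mul, add_comm]
  congr 1
  · by_cases h : y = o
    · simp [h, discount_of_notMem G (h ▸ hy)]
    · simp [h]
  · rw [← ENNReal.tsum_mul_left, ← ENNReal.tsum_mul_right]
    exact tsum_congr fun x => by rw [flow, G.symm]; ring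

variable {z o}

lemma tsum_flow (ho : o ∉ z) (s : ℝ≥0∞) :
    ∑' x, ∑' y, G.flow z o s x y = G.hitGenDeriv z s o := by
  have hw := G.vertexWeight_ne_zero o
  have hw' := G.vertexWeight_ne_top o
  have flow_left (x : V) : G.vertexWeight x * G.voltage z o s x * G.discount z s x =
      (G.vertexWeight o)⁻¹ * (G.vertexWeight x *
        (zᶜ.indicator (G.hitGen z s) x * G.green z s (({o} : Set V).indicator 1) x)) := by
    by_cases hx : x ∈ z
    · simp [hx, voltage]
    · simp only [voltage, discount_of_notMem G hx, div_eq_mul_inv, Set.mem_compl_iff, hx,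
        not_false_eq_true, Set.indicator_of_mem]
      ring
  simp_rw [tsum_flow_left, flow_left]
  rw [ENNReal.tsum_mul_left, tsum_vertexWeight_mul_green_comm, tsum_eq_single o]
  · simp [ho, ← mul_assoc, ENNReal.inv_mul_cancel hw hw', hitGenDeriv_eq_green]
  · intro x hx
    simp [hx]

end Reversibility

section Slowness

/-- The mean passage time per unit distance of the biased walk with odds `1` and `γ`. -/
def biasedSlowness (γ : ℝ) : ℝ := (γ + 1) / (γ - 1)

/-- Minus the derivative of `biasedSlowness` in the logarithm of the bias. -/
def slownessSlope (γ : ℝ) : ℝ := 2 * γ / (γ - 1) ^ 2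

/-- The intercept of the tangent of `biasedSlowness`, as a function of the logarithm of the bias. -/
def slownessIntercept (γ : ℝ) : ℝ := biasedSlowness γ + slownessSlope γ * Real.log γ

variable {γ : ℝ}

lemma slownessSlope_pos (hγ : 1 < γ) : 0 < slownessSlope γ := by
  have : 0 < γ - 1 := by linarith
  unfold slownessSlope
  positivity

lemma one_le_biasedSlowness (hγ : 1 < γ) : 1 ≤ biasedSlowness γ := by
  rw [biasedSlowness, le_div_iff₀ (by linarith)]
  linarith

lemma slownessIntercept_pos (hγ : 1 < γ) : 0 < slownessIntercept γ :=
  add_pos (zero_lt_one.trans_le (one_le_biasedSlowness hγ))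
    (mul_pos (slownessSlope_pos hγ) (Real.log_pos hγ))

lemma sub_mul_slownessIntercept_le {a b : ℝ} (hγ : 1 < γ) (hb : 0 < b) (hab : b ≤ a) :
    (a - b) * (slownessIntercept γ - slownessSlope γ * Real.log (a / b)) ≤ a + b := by
  have ha : 0 < a := hb.trans_le hab
  have hγ0 : 0 < γ := by linarith
  have hγ1 : 0 < γ - 1 := by linarith
  have log_le : Real.log γ - Real.log (a / b) ≤ γ * b / a - 1 := by
    rw [← Real.log_div hγ0.ne' (div_pos ha hb).ne', div_div_eq_mul_div]
    exact Real.log_le_sub_one_of_pos (by positivity)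
  calc (a - b) * (slownessIntercept γ - slownessSlope γ * Real.log (a / b))
      = (a - b) *
          (biasedSlowness γ + slownessSlope γ * (Real.log γ - Real.log (a / b))) := by
        rw [slownessIntercept]
        ring
    _ ≤ (a - b) * (biasedSlowness γ + slownessSlope γ * (γ * b / a - 1)) := by
        have := (slownessSlope_pos hγ).le
        have := sub_nonneg.2 hab
        gcongr
    _ = a + b - 2 * (γ * b - a) ^ 2 / (a * (γ - 1) ^ 2) := by
        unfold biasedSlowness slownessSlope
        field_simp
        ring
    _ ≤ a + b := sub_le_self _ (by positivity)

lemma sub_mul_sub_le_of_le {a b p q : ℝ} (hγ : 1 < γ) (hb : 0 < b) (hab : b ≤ a)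
    (h : p - q ≤ max 0 (slownessIntercept γ - slownessSlope γ * Real.log (a / b))) :
    (a - b) * (p - q) ≤ a + b := by
  refine (mul_le_mul_of_nonneg_left h (sub_nonneg.2 hab)).trans ?_
  rw [mul_max_of_nonneg _ _ (sub_nonneg.2 hab), mul_zero]
  exact max_le (by linarith) (sub_mul_slownessIntercept_le hγ hb hab)

lemma sub_mul_sub_le {a b p q : ℝ} (hγ : 1 < γ) (ha : 0 < a) (hb : 0 < b)
    (hpq : p - q ≤ max 0 (slownessIntercept γ - slownessSlope γ * Real.log (a / b)))
    (hqp : q - p ≤ max 0 (slownessIntercept γ - slownessSlope γ * Real.log (b / a))) :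
    (a - b) * (p - q) ≤ a + b := by
  rcases le_total b a with hab | hab
  · exact sub_mul_sub_le_of_le hγ hb hab hpq
  · linarith [sub_mul_sub_le_of_le hγ ha hab hqp]

lemma sub_mul_sub_add_half_le {a b p q : ℝ} (hγ : 1 < γ) (ha : 0 < a) (hb : 0 < b) (hqp : q ≤ p)
    (h : p - q ≤ max 0 (slownessIntercept γ / 2 - slownessSlope γ * Real.log (a / b))) :
    (a - b) * (p - q) + a / 2 ≤ a + b := by
  rcases le_total b a with hab | hab
  · have log_nonneg : 0 ≤ slownessSlope γ * Real.log (a / b) :=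
      mul_nonneg (slownessSlope_pos hγ).le (Real.log_nonneg ((one_le_div hb).2 hab))
    have doubled : 2 * p - 2 * q ≤
        max 0 (slownessIntercept γ - slownessSlope γ * Real.log (a / b)) := by
      rcases le_max_iff.1 h with h | h
      · exact le_max_of_le_left (by linarith)
      · exact le_max_of_le_right (by linarith)
    linarith [sub_mul_sub_le_of_le hγ hb hab doubled]
  · linarith [mul_nonneg (sub_nonneg.2 hab) (sub_nonneg.2 hqp)]

lemma mul_log_le_half_add {c t : ℝ} (hc : 0 < c) (ht : 0 < t) :
    c * Real.log t ≤ t / 2 + 2 * c ^ 2 := by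
  have log_scaled := Real.log_le_sub_one_of_pos (show 0 < t / (2 * c) by positivity)
  have log_scale := Real.log_le_sub_one_of_pos (show 0 < 2 * c by positivity)
  rw [Real.log_div ht.ne' (by positivity)] at log_scaled
  calc c * Real.log t ≤ c * (t / (2 * c) + 2 * c) := by gcongr; linarith
    _ = t / 2 + 2 * c ^ 2 := by field_simp

end Slowness

section TruncDist

variable (G : WeightedGraph V) (z : Set V) (n : ℕ)

/-- The graph distance to `z`, truncated at `n` so that it is finite. -/
def truncDist (x : V) : ℕ := (min (G.distToSet x z) n).toNat

variable {z} in
lemma truncDist_of_mem {x : V} (hx : x ∈ z) : G.truncDist z n x = 0 := by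
  have : G.distToSet x z = 0 := le_antisymm ((iInf₂_le x hx).trans (by simp)) zero_le
  simp [truncDist, this]

variable {z n} in
lemma truncDist_of_le {x : V} (h : (n : ℕ∞) ≤ G.distToSet x z) : G.truncDist z n x = n := by
  simp [truncDist, h]

variable {G} in
lemma distToSet_le_add_one {x y : V} (hw : G.weight x y ≠ 0) :
    G.distToSet x z ≤ G.distToSet y z + 1 := by
  have edist_le_one : G.toSimpleGraph.edist x y ≤ 1 := by
    rcases eq_or_ne x y with rfl | hxy
    · simp
    · have adj : G.toSimpleGraph.Adj x y := ⟨hxy, hw⟩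
      exact (SimpleGraph.edist_eq_one_iff_adj.2 adj).le
  simp only [distToSet, ENat.iInf_add]
  refine le_iInf₂ fun p hp => (iInf₂_le p hp).trans ?_
  rw [add_comm]
  exact SimpleGraph.edist_triangle.trans (by gcongr)

variable {G} in
lemma truncDist_le_add_one {x y : V} (hw : G.weight x y ≠ 0) :
    G.truncDist z n x ≤ G.truncDist z n y + 1 := by
  have min_le : min (G.distToSet x z) n ≤ min (G.distToSet y z) n + 1 := by
    rw [← min_add_add_right]
    exact min_le_min (distToSet_le_add_one z hw) le_self_add
  have min_ne_top (x : V) : min (G.distToSet x z) n ≠ ⊤ :=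
    ne_top_of_le_ne_top (ENat.natCast_ne_top n) (min_le_right _ _)
  rw [← ENat.natCast_toNat (min_ne_top x), ← ENat.natCast_toNat (min_ne_top y)] at min_le
  exact_mod_cast min_le

end TruncDist

section FlowSums

variable (G : WeightedGraph V) {z : Set V} {o : V} {s : ℝ≥0∞}

open scoped NNReal

lemma hasSum_toReal_prod {α β : Type*} {f : α → β → ℝ≥0∞} (h : ∑' x, ∑' y, f x y ≠ ∞) :
    HasSum (fun p : α × β => (f p.1 p.2).toReal) (∑' x, ∑' y, f x y).toReal := by
  rw [← ENNReal.tsum_prod] at h ⊢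
  rw [ENNReal.tsum_toReal_eq (ENNReal.ne_top_of_tsum_ne_top h)]
  exact ENNReal.hasSum_toReal h

lemma nonpos_of_hasSum_of_add_swap_nonpos {α : Type*} {f : α → α → ℝ} {a : ℝ}
    (hf : HasSum (fun p : α × α => f p.1 p.2) a) (h : ∀ x y, f x y + f y x ≤ 0) : a ≤ 0 := by
  have sum_swap : HasSum (fun p : α × α => f p.2 p.1) a := (Equiv.prodComm α α).hasSum_iff.2 hf
  linarith [hasSum_le (fun p : α × α => h p.1 p.2) (hf.add sum_swap) hasSum_zero]

lemma tsum_flow_mul_right (s : ℝ≥0∞) {ψ : V → ℝ≥0∞} (hψ : ∀ x ∈ z, ψ x = 0) :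
    (∑' x, ∑' y, G.flow z o s x y * ψ y) + G.hitGen z s o * ψ o =
      ∑' x, ∑' y, G.flow z o s x y * ψ x := by
  have origin : G.hitGen z s o * ψ o = ∑' y, ({o} : Set V).indicator (G.hitGen z s) y * ψ y := by
    rw [tsum_eq_single o fun y hy => by simp [hy]]
    simp
  rw [ENNReal.tsum_comm, origin, ← ENNReal.tsum_add]
  refine tsum_congr fun x => ?_
  simp_rw [ENNReal.tsum_mul_right, ← add_mul, tsum_flow_left]
  by_cases hx : x ∈ z
  · simp [hψ x hx]
  · rw [tsum_flow_right G o s hx]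

lemma hasSum_flow (ho : o ∉ z) (hs : s < 1) :
    HasSum (fun p : V × V => (G.flow z o s p.1 p.2).toReal) (G.hitGenDeriv z s o).toReal := by
  rw [← tsum_flow G ho]
  exact hasSum_toReal_prod (tsum_flow G ho s ▸ G.hitGenDeriv_ne_top z hs o)

lemma hasSum_flow_mul_sub (ho : o ∉ z) (hs : s < 1) {ψ : V → ℝ≥0} (hψ : ∀ x ∈ z, ψ x = 0)
    (hψo : ∀ x, ψ x ≤ ψ o) :
    HasSum (fun p : V × V => (G.flow z o s p.1 p.2).toReal * (ψ p.1 - ψ p.2))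
      ((G.hitGen z s o).toReal * ψ o) := by
  have by_parts := tsum_flow_mul_right G (o := o) s (ψ := fun x => ψ x) (z := z)
    fun x hx => by simp [hψ x hx]
  have left_ne_top : ∑' x, ∑' y, G.flow z o s x y * ψ x ≠ ∞ := by
    refine ne_top_of_le_ne_top (b := G.hitGenDeriv z s o * ψ o)
      (ENNReal.mul_ne_top (G.hitGenDeriv_ne_top z hs o) ENNReal.coe_ne_top) ?_
    simp_rw [← tsum_flow G ho, ← ENNReal.tsum_mul_right]
    gcongr
    exact hψo _
  have right_ne_top := ne_top_of_le_ne_top left_ne_top (le_self_add.trans by_parts.le)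
  have value : (∑' x, ∑' y, G.flow z o s x y * ψ x).toReal -
      (∑' x, ∑' y, G.flow z o s x y * ψ y).toReal = (G.hitGen z s o).toReal * ψ o := by
    rw [← by_parts, ENNReal.toReal_add right_ne_top
      (ne_top_of_le_ne_top left_ne_top (le_add_self.trans by_parts.le))]
    simp
  rw [← value]
  simpa only [ENNReal.toReal_mul, ENNReal.coe_toReal, mul_sub] using
    (hasSum_toReal_prod left_ne_top).sub (hasSum_toReal_prod right_ne_top)

lemma hasSum_flow_origin (ho : o ∉ z) (hs : s < 1) :
    HasSum (fun p : V × V => (G.flow z o s p.1 p.2).toReal * ({o} : Set V).indicator 1 p.1)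
      ((G.hitGen z s o).toReal * (G.vertexWeight o * G.voltage z o s o).toReal) := by
  have tsum_origin : ∑' x, ∑' y, G.flow z o s x y * ({o} : Set V).indicator 1 x =
      G.hitGen z s o * (G.vertexWeight o * G.voltage z o s o) := by
    simp_rw [ENNReal.tsum_mul_right]
    rw [tsum_eq_single o fun x hx => by simp [hx], tsum_flow_left, discount_of_notMem G ho]
    simp [mul_comm]
  have ne_top : G.hitGen z s o * (G.vertexWeight o * G.voltage z o s o) ≠ ∞ :=
    ENNReal.mul_ne_top (ne_top_of_le_ne_top ENNReal.one_ne_top (G.hitGen_le_one z hs.le o))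
      (ENNReal.mul_ne_top (G.vertexWeight_ne_top o) (G.voltage_ne_top z o hs o))
  rw [← ENNReal.toReal_mul, ← tsum_origin]
  convert hasSum_toReal_prod (tsum_origin ▸ ne_top) using 2 with p
  by_cases hp : p.1 = o <;> simp [hp]

lemma hasSum_weight_target (hz : G.setWeight z ≠ ∞) :
    HasSum (fun p : V × V => z.indicator 1 p.1 * (G.weight p.1 p.2).toReal)
      (G.setWeight z).toReal := by
  have tsum_target : ∑' x, ∑' y, z.indicator 1 x * G.weight x y = G.setWeight z := by
    simp_rw [ENNReal.tsum_mul_left]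
    rw [setWeight, tsum_subtype z G.vertexWeight]
    refine tsum_congr fun x => ?_
    by_cases hx : x ∈ z <;> simp [hx, vertexWeight]
  rw [← tsum_target]
  convert hasSum_toReal_prod (tsum_target ▸ hz) using 2 with p
  by_cases hp : p.1 ∈ z <;> simp [hp]

variable (z o s) in
/-- The contribution of the directed edge from `x` to `y` when the flow is tested against the
potential `ψ`. Half of the flow out of `o` is credited, and the edges leaving `z` are granted `ε`
times their weight. -/
def edgeExcess (ψ : V → ℝ≥0) (ε : ℝ) (x y : V) : ℝ :=
  (G.flow z o s x y).toReal * (ψ x - ψ y) +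
    (G.flow z o s x y).toReal * ({o} : Set V).indicator 1 x / 2 -
    (G.flow z o s x y).toReal - ε * (z.indicator 1 x * (G.weight x y).toReal)

lemma hasSum_edgeExcess (ho : o ∉ z) (hs : s < 1) (hz : G.setWeight z ≠ ∞)
    {ψ : V → ℝ≥0} (hψ : ∀ x ∈ z, ψ x = 0) (hψo : ∀ x, ψ x ≤ ψ o) (ε : ℝ) :
    HasSum (fun p : V × V => G.edgeExcess z o s ψ ε p.1 p.2)
      ((G.hitGen z s o).toReal * ψ o +
        (G.hitGen z s o).toReal * (G.vertexWeight o * G.voltage z o s o).toReal / 2 -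
        (G.hitGenDeriv z s o).toReal - ε * (G.setWeight z).toReal) := by
  unfold edgeExcess
  exact (((hasSum_flow_mul_sub G ho hs hψ hψo).add ((hasSum_flow_origin G ho hs).div_const 2)).sub
    (hasSum_flow G ho hs)).sub ((hasSum_weight_target G hz).mul_left ε)

lemma hitGen_mul_le_of_edgeExcess (ho : o ∉ z) (hs : s < 1) (hz : G.setWeight z ≠ ∞)
    {ψ : V → ℝ≥0} (hψ : ∀ x ∈ z, ψ x = 0) (hψo : ∀ x, ψ x ≤ ψ o) {ε : ℝ}
    (h : ∀ x y, G.edgeExcess z o s ψ ε x y + G.edgeExcess z o s ψ ε y x ≤ 0) :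
    (G.hitGen z s o).toReal * (ψ o + (G.vertexWeight o * G.voltage z o s o).toReal / 2) ≤
      (G.hitGenDeriv z s o).toReal + ε * (G.setWeight z).toReal := by
  have sum_nonpos := nonpos_of_hasSum_of_add_swap_nonpos
    (hasSum_edgeExcess G ho hs hz hψ hψo ε) h
  linarith only [sum_nonpos]

end FlowSums

section Potential

variable (G : WeightedGraph V) {z : Set V} {o : V} {s : ℝ≥0∞} {n : ℕ} {γ W : ℝ} {x y : V}

open scoped NNReal

lemma discount_ne_zero_of_adj (hs : s ≠ 0) (hx : x ∉ z) (hw : G.weight x y ≠ 0)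
    (hy : G.discount z s y ≠ 0) : G.discount z s x ≠ 0 := by
  refine right_ne_zero_of_mul (a := G.vertexWeight x) ?_
  rw [vertexWeight_mul_discount G hx]
  exact mul_ne_zero hs fun h => mul_ne_zero hw hy (ENNReal.tsum_eq_zero.1 h y)

lemma voltage_ne_zero_of_adj (hs : s ≠ 0) (hx : x ∉ z) (hw : G.weight x y ≠ 0)
    (hy : G.voltage z o s y ≠ 0) : G.voltage z o s x ≠ 0 := by
  refine right_ne_zero_of_mul (a := G.vertexWeight x) ?_
  rw [vertexWeight_mul_voltage G o hx]
  exact fun h => mul_ne_zero hs (fun h => mul_ne_zero hw hy (ENNReal.tsum_eq_zero.1 h y))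
    (add_eq_zero.1 h).2

lemma voltage_self_ne_zero (ho : o ∉ z) (s : ℝ≥0∞) : G.voltage z o s o ≠ 0 := by
  refine right_ne_zero_of_mul (a := G.vertexWeight o) ?_
  rw [vertexWeight_mul_voltage G o ho]
  simp

lemma toReal_flow (z : Set V) (o : V) (s : ℝ≥0∞) (x y : V) : (G.flow z o s x y).toReal =
    s.toReal * (G.weight x y).toReal * (G.voltage z o s x).toReal * (G.discount z s y).toReal := by
  simp [flow]

lemma flow_of_mem (hx : x ∈ z) (s : ℝ≥0∞) (y : V) : G.flow z o s x y = 0 := by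
  simp [flow, voltage_of_mem G o hx]

lemma flow_ne_top (hs : s < 1) (x y : V) : G.flow z o s x y ≠ ∞ :=
  ENNReal.mul_ne_top (ENNReal.mul_ne_top (ENNReal.mul_ne_top hs.ne_top (G.weight_ne_top x y))
    (G.voltage_ne_top z o hs x))
    (ne_top_of_le_ne_top ENNReal.one_ne_top (G.discount_le_one z hs.le y))

lemma weight_ne_zero_of_flow (h : G.flow z o s x y ≠ 0) : G.weight x y ≠ 0 :=
  fun hw => h (by simp [flow, hw])

lemma flow_swap_ne_zero (hx : x ∉ z) (hy : y ∉ z) (h : G.flow z o s x y ≠ 0) :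
    G.flow z o s y x ≠ 0 := by
  simp only [flow, mul_ne_zero_iff] at h ⊢
  obtain ⟨⟨⟨hs, hw⟩, hv⟩, hu⟩ := h
  have hw' : G.weight y x ≠ 0 := G.symm x y ▸ hw
  exact ⟨⟨⟨hs, hw'⟩, G.voltage_ne_zero_of_adj hs hy hw' hv⟩, G.discount_ne_zero_of_adj hs hx hw hu⟩

variable (z o s n γ W) in
/-- The truncated distance to `z`, lowered by `1 / 2` at `o` and tilted by the logarithm of the
ratio of the voltage to the discount; the scale `W` of the voltage is free. -/
def tiltedHeight (x : V) : ℝ :=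
  slownessIntercept γ * (G.truncDist z n x - ({o} : Set V).indicator 1 x / 2 - 1) -
    slownessSlope γ * Real.log (W * (G.voltage z o s x).toReal / (G.discount z s x).toReal)

variable (z o s n γ W) in
/-- The potential against which the discounted flow is tested: the tilted height clamped between
`0` and its value at `o`. -/
def potential : V → ℝ≥0 :=
  zᶜ.indicator fun x =>
    (min (G.tiltedHeight z o s n γ W x) (G.tiltedHeight z o s n γ W o)).toNNReal

lemma potential_of_mem (hx : x ∈ z) : G.potential z o s n γ W x = 0 :=
  Set.indicator_of_notMem (not_not.2 hx) _

lemma coe_potential_of_notMem (hx : x ∉ z) : (G.potential z o s n γ W x : ℝ) =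
    max (min (G.tiltedHeight z o s n γ W x) (G.tiltedHeight z o s n γ W o)) 0 := by
  rw [potential, Set.indicator_of_mem (show x ∈ zᶜ from hx), Real.coe_toNNReal']

lemma potential_le_origin (ho : o ∉ z) (x : V) :
    G.potential z o s n γ W x ≤ G.potential z o s n γ W o := by
  by_cases hx : x ∈ z
  · simp [potential_of_mem G hx]
  · rw [← NNReal.coe_le_coe, coe_potential_of_notMem G hx, coe_potential_of_notMem G ho, min_self]
    exact max_le_max_right _ (min_le_right _ _)

lemma clamp_sub_le (B t₁ t₂ : ℝ) :
    max (min t₁ B) 0 - max (min t₂ B) 0 ≤ max 0 (t₁ - t₂) := by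
  grind

lemma potential_sub_le (hx : x ∉ z) (hy : y ∉ z) :
    (G.potential z o s n γ W x : ℝ) - G.potential z o s n γ W y ≤
      max 0 (G.tiltedHeight z o s n γ W x - G.tiltedHeight z o s n γ W y) := by
  rw [coe_potential_of_notMem G hx, coe_potential_of_notMem G hy]
  exact clamp_sub_le _ _ _

lemma tiltedHeight_sub (hs : s < 1) (hW : 0 < W) (hx : x ∉ z) (hy : y ∉ z)
    (h : G.flow z o s x y ≠ 0) :
    G.tiltedHeight z o s n γ W x - G.tiltedHeight z o s n γ W y =
      slownessIntercept γ * ((G.truncDist z n x - ({o} : Set V).indicator 1 x / 2) -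
        (G.truncDist z n y - ({o} : Set V).indicator 1 y / 2)) -
      slownessSlope γ * Real.log ((G.flow z o s x y).toReal / (G.flow z o s y x).toReal) := by
  have h₁ := ENNReal.toReal_ne_zero.2 ⟨h, G.flow_ne_top hs x y⟩
  have h₂ := ENNReal.toReal_ne_zero.2 ⟨G.flow_swap_ne_zero hx hy h, G.flow_ne_top hs y x⟩
  simp only [toReal_flow, G.symm y x, ne_eq, mul_eq_zero, not_or] at h₁ h₂ ⊢
  obtain ⟨⟨⟨hs0, hw⟩, hvx⟩, huy⟩ := h₁
  obtain ⟨⟨-, hvy⟩, hux⟩ := h₂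
  have log_ratio : Real.log (W * (G.voltage z o s x).toReal / (G.discount z s x).toReal) -
      Real.log (W * (G.voltage z o s y).toReal / (G.discount z s y).toReal) =
      Real.log (s.toReal * (G.weight x y).toReal * (G.voltage z o s x).toReal *
        (G.discount z s y).toReal / (s.toReal * (G.weight x y).toReal *
        (G.voltage z o s y).toReal * (G.discount z s x).toReal)) := by
    rw [← Real.log_div (by positivity) (by positivity)]
    congr 1
    field_simp
  rw [← log_ratio, tiltedHeight, tiltedHeight]
  ring

lemma mul_potential_le (hs : s < 1) (hγ : 1 < γ) (hW : 0 < W) (hx : x ∉ z) (hxo : x ≠ o)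
    (hd : G.truncDist z n x ≤ 1) :
    (G.voltage z o s x).toReal * G.potential z o s n γ W x ≤ slownessSlope γ / W := by
  have hc := slownessSlope_pos hγ
  have hu : 0 ≤ (G.discount z s x).toReal := ENNReal.toReal_nonneg
  have hu_le := ENNReal.toReal_mono ENNReal.one_ne_top (G.discount_le_one z hs.le x)
  rw [ENNReal.toReal_one] at hu_le
  rcases ENNReal.toReal_nonneg (a := G.voltage z o s x) |>.eq_or_lt with hv | hv
  · rw [← hv, zero_mul]
    positivity
  set v := (G.voltage z o s x).toReal
  set u := (G.discount z s x).toReal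
  have neg_log_le : -Real.log (W * v / u) ≤ 1 / (W * v) := calc
    -Real.log (W * v / u) = Real.log (u / (W * v)) := by rw [← Real.log_inv, inv_div]
    _ ≤ u / (W * v) := Real.log_le_self (by positivity)
    _ ≤ 1 / (W * v) := by gcongr
  have height_le : slownessIntercept γ * ((G.truncDist z n x : ℝ) - 0 / 2 - 1) ≤ 0 :=
    mul_nonpos_of_nonneg_of_nonpos (slownessIntercept_pos hγ).le (by
      have : (G.truncDist z n x : ℝ) ≤ 1 := by exact_mod_cast hd
      linarith)
  have tilted_le : G.tiltedHeight z o s n γ W x ≤ slownessSlope γ * (1 / (W * v)) := by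
    rw [tiltedHeight, Set.indicator_of_notMem (show x ∉ ({o} : Set V) from hxo)]
    linarith [mul_le_mul_of_nonneg_left neg_log_le hc.le]
  rw [coe_potential_of_notMem G hx]
  calc v * max (min _ _) 0 ≤ v * (slownessSlope γ * (1 / (W * v))) := by
        gcongr
        exact max_le ((min_le_left _ _).trans tilted_le) (by positivity)
    _ = slownessSlope γ / W := by field_simp

end Potential

section ConditionedSpeed

variable (G : WeightedGraph V) {z : Set V} {o : V} {s : ℝ≥0∞} {n : ℕ} {γ W : ℝ} {x y : V}

lemma edgeExcess_add_swap_into_target (hs : s < 1) (hγ : 1 < γ) (hW : 0 < W) (hx : x ∉ z)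
    (hy : y ∈ z) (hxo : x ≠ o) (hyo : y ≠ o) (hw : G.weight x y ≠ 0) :
    G.edgeExcess z o s (G.potential z o s n γ W) (slownessSlope γ / W) x y +
      G.edgeExcess z o s (G.potential z o s n γ W) (slownessSlope γ / W) y x ≤ 0 := by
  have dist_le : G.truncDist z n x ≤ 1 := by
    simpa [truncDist_of_mem G n hy] using truncDist_le_add_one z n hw
  have potential_le := G.mul_potential_le (n := n) hs hγ hW hx hxo dist_le
  have s_le : s.toReal ≤ 1 := by simpa using ENNReal.toReal_mono ENNReal.one_ne_top hs.le
  have flow_mul_le : (G.flow z o s x y).toReal * G.potential z o s n γ W x ≤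
      slownessSlope γ / W * (G.weight x y).toReal := calc
    _ = s.toReal * (G.weight x y).toReal *
          ((G.voltage z o s x).toReal * G.potential z o s n γ W x) := by
        rw [toReal_flow, discount_of_mem G hy, ENNReal.toReal_one]
        ring
    _ ≤ 1 * (G.weight x y).toReal * (slownessSlope γ / W) := by gcongr
    _ = _ := by ring
  have flow_nonneg : 0 ≤ (G.flow z o s x y).toReal := ENNReal.toReal_nonneg
  simp only [edgeExcess, flow_of_mem G hy, potential_of_mem G hy, Set.indicator_of_mem hy,
    Set.indicator_of_notMem hx, Set.indicator_of_notMem (show x ∉ ({o} : Set V) from hxo),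
    Set.indicator_of_notMem (show y ∉ ({o} : Set V) from hyo), G.symm y x, NNReal.coe_zero,
    ENNReal.toReal_zero, Pi.one_apply]
  linarith

lemma edgeExcess_add_swap_interior (hs : s < 1) (hγ : 1 < γ) (hW : 0 < W) (hx : x ∉ z)
    (hy : y ∉ z) (hxo : x ≠ o) (hyo : y ≠ o) (hf : G.flow z o s x y ≠ 0) (ε : ℝ) :
    G.edgeExcess z o s (G.potential z o s n γ W) ε x y +
      G.edgeExcess z o s (G.potential z o s n γ W) ε y x ≤ 0 := by
  have flow_pos {x y : V} (h : G.flow z o s x y ≠ 0) : 0 < (G.flow z o s x y).toReal :=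
    ENNReal.toReal_pos h (G.flow_ne_top hs x y)
  have hf' := G.flow_swap_ne_zero hx hy hf
  have sub_le {x y : V} (hx : x ∉ z) (hy : y ∉ z) (hxo : x ≠ o) (hyo : y ≠ o)
      (hf : G.flow z o s x y ≠ 0) :
      (G.potential z o s n γ W x : ℝ) - G.potential z o s n γ W y ≤
        max 0 (slownessIntercept γ - slownessSlope γ *
          Real.log ((G.flow z o s x y).toReal / (G.flow z o s y x).toReal)) := by
    have dist_le : (G.truncDist z n x : ℝ) ≤ G.truncDist z n y + 1 := by
      exact_mod_cast truncDist_le_add_one z n (G.weight_ne_zero_of_flow hf)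
    refine (G.potential_sub_le hx hy).trans (max_le_max_left 0 ?_)
    rw [G.tiltedHeight_sub hs hW hx hy hf,
      Set.indicator_of_notMem (show x ∉ ({o} : Set V) from hxo),
      Set.indicator_of_notMem (show y ∉ ({o} : Set V) from hyo)]
    gcongr
    exact mul_le_of_le_one_right (slownessIntercept_pos hγ).le (by linarith)
  have := sub_mul_sub_le hγ (flow_pos hf) (flow_pos hf') (sub_le hx hy hxo hyo hf)
    (sub_le hy hx hyo hxo hf')
  simp only [edgeExcess, Set.indicator_of_notMem hx, Set.indicator_of_notMem hy,
    Set.indicator_of_notMem (show x ∉ ({o} : Set V) from hxo),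
    Set.indicator_of_notMem (show y ∉ ({o} : Set V) from hyo)]
  linarith

lemma edgeExcess_add_swap_origin (hs : s < 1) (hγ : 1 < γ) (hW : 0 < W) (ho : o ∉ z)
    (hy : y ∉ z) (hyo : y ≠ o) (hf : G.flow z o s o y ≠ 0) (ε : ℝ) :
    G.edgeExcess z o s (G.potential z o s n γ W) ε o y +
      G.edgeExcess z o s (G.potential z o s n γ W) ε y o ≤ 0 := by
  have flow_pos {x y : V} (h : G.flow z o s x y ≠ 0) : 0 < (G.flow z o s x y).toReal :=
    ENNReal.toReal_pos h (G.flow_ne_top hs x y)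
  have hf' := G.flow_swap_ne_zero ho hy hf
  have dist_le : (G.truncDist z n o : ℝ) ≤ G.truncDist z n y + 1 := by
    exact_mod_cast truncDist_le_add_one z n (G.weight_ne_zero_of_flow hf)
  have sub_le : (G.potential z o s n γ W o : ℝ) - G.potential z o s n γ W y ≤
      max 0 (slownessIntercept γ / 2 - slownessSlope γ *
        Real.log ((G.flow z o s o y).toReal / (G.flow z o s y o).toReal)) := by
    refine (G.potential_sub_le ho hy).trans (max_le_max_left 0 ?_)
    rw [G.tiltedHeight_sub hs hW ho hy hf, Set.indicator_of_mem (Set.mem_singleton o),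
      Set.indicator_of_notMem (show y ∉ ({o} : Set V) from hyo), Pi.one_apply,
      div_eq_mul_one_div (slownessIntercept γ)]
    gcongr
    · exact (slownessIntercept_pos hγ).le
    · linarith
  have := sub_mul_sub_add_half_le hγ (flow_pos hf) (flow_pos hf')
    (NNReal.coe_le_coe.2 (G.potential_le_origin ho y)) sub_le
  simp only [edgeExcess, Set.indicator_of_notMem ho, Set.indicator_of_notMem hy,
    Set.indicator_of_mem (Set.mem_singleton o),
    Set.indicator_of_notMem (show y ∉ ({o} : Set V) from hyo), Pi.one_apply]
  linarith

lemma edgeExcess_add_swap_nonpos_of_notMem (hs : s < 1) (hγ : 1 < γ) (hW : 0 < W) (hx : x ∉ z)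
    (hy : y ∉ z) (ε : ℝ) :
    G.edgeExcess z o s (G.potential z o s n γ W) ε x y +
      G.edgeExcess z o s (G.potential z o s n γ W) ε y x ≤ 0 := by
  by_cases hf : G.flow z o s x y = 0
  · have hf' : G.flow z o s y x = 0 := not_not.1 fun h => G.flow_swap_ne_zero hy hx h hf
    simp [edgeExcess, hf, hf', hx, hy]
  rcases eq_or_ne x o with hxo | hxo <;> rcases eq_or_ne y o with hyo | hyo
  · subst hxo
    subst hyo
    simp only [edgeExcess, Set.indicator_of_notMem hx, sub_self,
      Set.indicator_of_mem (Set.mem_singleton y), Pi.one_apply]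
    linarith [ENNReal.toReal_nonneg (a := G.flow z y s y y)]
  · subst hxo
    exact G.edgeExcess_add_swap_origin hs hγ hW hx hy hyo hf ε
  · subst hyo
    rw [add_comm]
    exact G.edgeExcess_add_swap_origin hs hγ hW hy hx hxo (G.flow_swap_ne_zero hx hy hf) ε
  · exact G.edgeExcess_add_swap_interior hs hγ hW hx hy hxo hyo hf ε

lemma edgeExcess_add_swap_nonpos (hs : s < 1) (hγ : 1 < γ) (hW : 0 < W) (hn : 2 ≤ n)
    (hdist : (n : ℕ∞) ≤ G.distToSet o z) (x y : V) :
    G.edgeExcess z o s (G.potential z o s n γ W) (slownessSlope γ / W) x y +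
      G.edgeExcess z o s (G.potential z o s n γ W) (slownessSlope γ / W) y x ≤ 0 := by
  have ne_origin_of_mem {x : V} (hx : x ∈ z) : x ≠ o := by
    rintro rfl
    have := G.truncDist_of_mem n hx
    rw [G.truncDist_of_le hdist] at this
    omega
  have ne_origin_of_adj {x y : V} (hy : y ∈ z) (hw : G.weight x y ≠ 0) : x ≠ o := by
    rintro rfl
    have := truncDist_le_add_one z n hw
    rw [G.truncDist_of_mem n hy, G.truncDist_of_le hdist] at this
    omega
  have hc := slownessSlope_pos hγ
  by_cases hw : G.weight x y = 0
  · have hw' : G.weight y x = 0 := G.symm x y ▸ hw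
    simp [edgeExcess, flow, hw, hw']
  by_cases hx : x ∈ z <;> by_cases hy : y ∈ z
  · simp only [edgeExcess, flow_of_mem G hx, flow_of_mem G hy, ENNReal.toReal_zero, zero_mul,
      zero_div, add_zero, sub_zero, zero_sub, Set.indicator_of_mem hx, Set.indicator_of_mem hy,
      Pi.one_apply, one_mul]
    exact add_nonpos (neg_nonpos.2 (by positivity)) (neg_nonpos.2 (by positivity))
  · have hw' : G.weight y x ≠ 0 := G.symm x y ▸ hw
    rw [add_comm]
    exact G.edgeExcess_add_swap_into_target hs hγ hW hy hx (ne_origin_of_adj hx hw')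
      (ne_origin_of_mem hx) hw'
  · exact G.edgeExcess_add_swap_into_target hs hγ hW hx hy (ne_origin_of_adj hy hw)
      (ne_origin_of_mem hy) hw
  · exact G.edgeExcess_add_swap_nonpos_of_notMem hs hγ hW hx hy _

lemma tiltedHeight_origin (ho : o ∉ z) (hs : s < 1) (hdist : (n : ℕ∞) ≤ G.distToSet o z)
    {R F w : ℝ} (hR : 0 < R) (hF : 0 < F) (hw : 0 < w) (hitGen_eq : (G.hitGen z s o).toReal = F) :
    G.tiltedHeight z o s n γ (R * w / F) o = slownessIntercept γ * (n - 3 / 2) -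
      slownessSlope γ *
        (Real.log (R / F ^ 2) + Real.log (w * (G.voltage z o s o).toReal)) := by
  have hv := ENNReal.toReal_pos (G.voltage_self_ne_zero ho s) (G.voltage_ne_top z o hs o)
  set v := (G.voltage z o s o).toReal
  rw [tiltedHeight, discount_of_notMem G ho, hitGen_eq, G.truncDist_of_le hdist,
    ← Real.log_mul (by positivity) (by positivity), Set.indicator_of_mem (Set.mem_singleton o),
    Pi.one_apply, show R * w / F * v / F = R / F ^ 2 * (w * v) by field_simp]
  ring

lemma hitGen_mul_le_hitGenDeriv (hs : s < 1) (hγ : 1 < γ) (hn : 2 ≤ n)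
    (hdist : (n : ℕ∞) ≤ G.distToSet o z) {R F : ℝ} (hR : 0 < R) (hF : 0 < F)
    (hz : G.setWeight z ≤ ENNReal.ofReal R * G.vertexWeight o)
    (hitGen_eq : (G.hitGen z s o).toReal = F) :
    F * (slownessIntercept γ * (n - 3 / 2) - slownessSlope γ * Real.log (R / F ^ 2) -
      slownessSlope γ - 2 * slownessSlope γ ^ 2) ≤ (G.hitGenDeriv z s o).toReal := by
  have ho : o ∉ z := fun h => by
    have := G.truncDist_of_mem n h
    rw [G.truncDist_of_le hdist] at this
    omega
  have hc := slownessSlope_pos hγ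
  have hw := ENNReal.toReal_pos (G.vertexWeight_ne_zero o) (G.vertexWeight_ne_top o)
  have hv := ENNReal.toReal_pos (G.voltage_self_ne_zero ho s) (G.voltage_ne_top z o hs o)
  have rhs_ne_top := ENNReal.mul_ne_top (ENNReal.ofReal_ne_top (r := R)) (G.vertexWeight_ne_top o)
  have hz' := ENNReal.toReal_mono rhs_ne_top hz
  rw [ENNReal.toReal_mul, ENNReal.toReal_ofReal hR.le] at hz'
  set w := (G.vertexWeight o).toReal
  set v := (G.voltage z o s o).toReal
  -- At this scale the excess on the edges into the target is at most a constant times `F`.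
  have hW : 0 < R * w / F := by positivity
  have tested := G.hitGen_mul_le_of_edgeExcess ho hs (ne_top_of_le_ne_top rhs_ne_top hz)
    (fun x hx => G.potential_of_mem hx) (G.potential_le_origin ho)
    (G.edgeExcess_add_swap_nonpos hs hγ hW hn hdist)
  have target_le : slownessSlope γ / (R * w / F) * (G.setWeight z).toReal ≤
      F * slownessSlope γ := calc
    _ ≤ slownessSlope γ / (R * w / F) * (R * w) := by gcongr
    _ = F * slownessSlope γ := by field_simp
  have tilted_origin := G.tiltedHeight_origin (γ := γ) ho hs hdist hR hF hw hitGen_eq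
  have potential_ge : G.tiltedHeight z o s n γ (R * w / F) o ≤
      G.potential z o s n γ (R * w / F) o := by
    rw [coe_potential_of_notMem G ho, min_self]
    exact le_max_left _ _
  have log_le := mul_log_le_half_add hc (mul_pos hw hv)
  rw [hitGen_eq, ENNReal.toReal_mul] at tested
  have bracket_le : slownessIntercept γ * (n - 3 / 2) - slownessSlope γ * Real.log (R / F ^ 2) -
      2 * slownessSlope γ ^ 2 ≤ G.potential z o s n γ (R * w / F) o + w * v / 2 := by
    linarith
  linarith [mul_le_mul_of_nonneg_left bracket_le hF.le]

end ConditionedSpeed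

section LogDiscount

/-- The logarithm of the discount factor `s` at which the biased walk has `E s ^ T' = exp L`. -/
def logDiscount (g L : ℝ) : ℝ := Real.log (g + 1) + L - Real.log (g + Real.exp (2 * L))

variable {g L : ℝ}

lemma logDiscount_zero (g : ℝ) : logDiscount g 0 = 0 := by simp [logDiscount]

lemma inv_biasedSlowness_mul_exp (g L : ℝ) :
    (biasedSlowness (g * Real.exp (-(2 * L))))⁻¹ =
      (g - Real.exp (2 * L)) / (g + Real.exp (2 * L)) := by
  have exp_ne_zero := (Real.exp_pos (2 * L)).ne'
  rw [biasedSlowness, Real.exp_neg, ← div_eq_mul_inv, inv_div, div_sub_one exp_ne_zero,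
    div_add_one exp_ne_zero, div_div_div_cancel_right₀ exp_ne_zero]

lemma hasDerivAt_logDiscount (hg : 0 < g) (L : ℝ) :
    HasDerivAt (logDiscount g) (biasedSlowness (g * Real.exp (-(2 * L))))⁻¹ L := by
  have sum_pos : 0 < g + Real.exp (2 * L) := by positivity
  have hasDerivAt_exp : HasDerivAt (fun L => Real.exp (2 * L)) (Real.exp (2 * L) * 2) L := by
    simpa using ((hasDerivAt_id L).const_mul 2).exp
  refine (((hasDerivAt_id L).const_add (Real.log (g + 1))).sub
    ((hasDerivAt_exp.const_add g).log sum_pos.ne')).congr_deriv ?_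
  rw [inv_biasedSlowness_mul_exp]
  field_simp
  ring

lemma le_mul_exp_neg (hg : 0 ≤ g) (hL : L ≤ 0) : g ≤ g * Real.exp (-(2 * L)) :=
  le_mul_of_one_le_right hg (Real.one_le_exp (by linarith))

lemma strictMonoOn_logDiscount (hg : 1 < g) : StrictMonoOn (logDiscount g) (Set.Iic 0) := by
  have hg0 : 0 < g := by linarith
  refine strictMonoOn_of_deriv_pos (convex_Iic 0)
    (fun L _ => (hasDerivAt_logDiscount hg0 L).continuousAt.continuousWithinAt) fun L hL => ?_
  rw [interior_Iic] at hL
  rw [(hasDerivAt_logDiscount hg0 L).deriv]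
  have := one_le_biasedSlowness (hg.trans_le (le_mul_exp_neg hg0.le (Set.mem_Iio.1 hL).le))
  positivity

lemma logDiscount_nonpos (hg : 1 < g) (hL : L ≤ 0) : logDiscount g L ≤ 0 :=
  logDiscount_zero g ▸
    (strictMonoOn_logDiscount hg).monotoneOn hL (Set.mem_Iic.2 le_rfl) hL

lemma logDiscount_neg (hg : 1 < g) (hL : L < 0) : logDiscount g L < 0 :=
  logDiscount_zero g ▸ strictMonoOn_logDiscount hg hL.le (Set.mem_Iic.2 le_rfl) hL

lemma le_mul_of_monotoneOn_sub_mul {h : ℝ → ℝ} {c σ : ℝ}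
    (hmono : MonotoneOn (fun τ => h τ - c * τ) (Set.Iio 0)) (h_nonpos : ∀ τ < 0, h τ ≤ 0)
    (hσ : σ < 0) : h σ ≤ c * σ := by
  have tendsto_zero : Tendsto (fun τ : ℝ => -(c * τ)) (nhdsWithin 0 (Set.Iio 0)) (nhds 0) := by
    have continuous_neg_mul : Continuous fun τ : ℝ => -(c * τ) := by fun_prop
    simpa using (continuous_neg_mul.tendsto 0).mono_left nhdsWithin_le_nhds
  refine sub_nonpos.1 (ge_of_tendsto tendsto_zero ?_)
  filter_upwards [Ioo_mem_nhdsLT hσ] with τ ⟨hστ, hτ⟩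
  exact (hmono hσ hτ hστ.le).trans (by linarith [h_nonpos τ hτ])

lemma logDiscount_comp_le {c : ℝ} {L L' : ℝ → ℝ} (hg : 1 < g)
    (hL : ∀ σ < 0, HasDerivAt L (L' σ) σ) (L_nonpos : ∀ σ < 0, L σ ≤ 0)
    (hL' : ∀ σ < 0, biasedSlowness (g * Real.exp (-(2 * L σ))) * c ≤ L' σ) {σ : ℝ} (hσ : σ < 0) :
    logDiscount g (L σ) ≤ c * σ := by
  have hg0 : 0 < g := by linarith
  have hasDerivAt_sub : ∀ τ < 0, HasDerivAt (fun τ => logDiscount g (L τ) - c * τ)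
      ((biasedSlowness (g * Real.exp (-(2 * L τ))))⁻¹ * L' τ - c) τ := fun τ hτ =>
    (((hasDerivAt_logDiscount hg0 (L τ)).comp τ (hL τ hτ)).sub
      ((hasDerivAt_id τ).const_mul c)).congr_deriv (by rw [mul_one])
  refine le_mul_of_monotoneOn_sub_mul ?_ (fun τ hτ => logDiscount_nonpos hg (L_nonpos τ hτ)) hσ
  refine monotoneOn_of_deriv_nonneg (convex_Iio 0)
    (fun τ hτ => (hasDerivAt_sub τ hτ).continuousAt.continuousWithinAt) ?_ ?_ <;>
    rw [interior_Iio]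
  · exact fun τ hτ => (hasDerivAt_sub τ hτ).differentiableAt.differentiableWithinAt
  · intro τ hτ
    rw [(hasDerivAt_sub τ hτ).deriv, sub_nonneg, ← div_eq_inv_mul,
      le_div_iff₀' (zero_lt_one.trans_le (one_le_biasedSlowness
        (hg.trans_le (le_mul_exp_neg hg0.le (L_nonpos τ hτ)))))]
    exact hL' τ hτ

end LogDiscount

section StepLoss

/-- The number of steps by which a walk to distance `n` may beat the biased walk: the comparison is
with the biased walk to distance `n - stepLoss C g`. -/
def stepLoss (C g : ℝ) : ℝ :=
  3 / 2 * (biasedSlowness g + 2 * g / (g - 1)) +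
    slownessSlope g * (Real.log C + 1 + 2 * slownessSlope g)

variable {C g γ : ℝ}

lemma stepLoss_nonneg (hC : 1 ≤ C) (hg : 1 < g) : 0 ≤ stepLoss C g := by
  have := one_le_biasedSlowness hg
  have := slownessSlope_pos hg
  have := Real.log_nonneg hC
  have : 0 < g - 1 := by linarith
  unfold stepLoss
  positivity

lemma biasedSlowness_anti (hg : 1 < g) (h : g ≤ γ) : biasedSlowness γ ≤ biasedSlowness g := by
  unfold biasedSlowness
  rw [div_le_div_iff₀ (by linarith) (by linarith)]
  nlinarith

lemma slownessSlope_anti (hg : 1 < g) (h : g ≤ γ) : slownessSlope γ ≤ slownessSlope g := by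
  have : 0 < g - 1 := by linarith
  have : 0 < γ - 1 := by linarith
  unfold slownessSlope
  rw [div_le_div_iff₀ (by positivity) (by positivity), ← sub_nonneg]
  have : 0 ≤ (γ - g) * (γ * g - 1) := mul_nonneg (by linarith) (by nlinarith)
  linarith

lemma slownessIntercept_le (hg : 1 < g) (h : g ≤ γ) :
    slownessIntercept γ ≤ biasedSlowness g + 2 * g / (g - 1) := by
  have g_sub_pos : 0 < g - 1 := by linarith
  have γ_sub_pos : 0 < γ - 1 := by linarith
  refine add_le_add (biasedSlowness_anti hg h) ?_
  calc slownessSlope γ * Real.log γ ≤ slownessSlope γ * (γ - 1) := by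
        have := (slownessSlope_pos (hg.trans_le h)).le
        gcongr
        exact Real.log_le_sub_one_of_pos (by linarith)
    _ = 2 * γ / (γ - 1) := by
        unfold slownessSlope
        field_simp
    _ ≤ 2 * g / (g - 1) := by
        rw [div_le_div_iff₀ γ_sub_pos g_sub_pos]
        linarith

lemma biasedSlowness_mul_sub_stepLoss_le (hC : 1 ≤ C) (hg : 1 < g) (h : g ≤ γ) (n : ℝ) :
    biasedSlowness γ * (n - stepLoss C g) ≤ slownessIntercept γ * (n - 3 / 2) -
      slownessSlope γ * (Real.log C + n * Real.log γ) - slownessSlope γ -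
        2 * slownessSlope γ ^ 2 := by
  have slope_pos := slownessSlope_pos (hg.trans_le h)
  have slope_pos' := slownessSlope_pos hg
  have log_nonneg := Real.log_nonneg hC
  have slope_term_le : slownessSlope γ * (Real.log C + 1 + 2 * slownessSlope γ) ≤
      slownessSlope g * (Real.log C + 1 + 2 * slownessSlope g) := by
    have := slownessSlope_anti hg h
    gcongr
  have loss_le : stepLoss C g ≤ biasedSlowness γ * stepLoss C g :=
    le_mul_of_one_le_left (stepLoss_nonneg hC hg) (one_le_biasedSlowness (hg.trans_le h))
  have loss_ge : 3 / 2 * slownessIntercept γ +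
      slownessSlope γ * (Real.log C + 1 + 2 * slownessSlope γ) ≤ stepLoss C g :=
    add_le_add (mul_le_mul_of_nonneg_left (slownessIntercept_le hg h) (by norm_num)) slope_term_le
  calc biasedSlowness γ * (n - stepLoss C g)
      ≤ biasedSlowness γ * n - 3 / 2 * slownessIntercept γ -
          slownessSlope γ * (Real.log C + 1 + 2 * slownessSlope γ) := by linarith
    _ = _ := by
        unfold slownessIntercept
        ring

end StepLoss

section ExpSeries

variable {σ : ℝ}

lemma summable_succ_mul_exp (hσ : σ < 0) :
    Summable fun k : ℕ => ((k : ℝ) + 1) * Real.exp ((k + 1) * σ) := by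
  have exp_lt_one : ‖Real.exp σ‖ < 1 := by
    rw [Real.norm_of_nonneg (Real.exp_pos σ).le, Real.exp_lt_one_iff]
    exact hσ
  have summable_shift :=
    (summable_nat_add_iff 1).2 (summable_pow_mul_geometric_of_norm_lt_one (R := ℝ) 1 exp_lt_one)
  refine summable_shift.congr fun k => ?_
  rw [← Real.exp_nat_mul]
  push_cast
  ring

lemma summable_exp_mul {p : ℕ → ℝ} (hp0 : ∀ k, 0 ≤ p k) (hp1 : ∀ k, p k ≤ 1) (hσ : σ < 0) :
    Summable fun k : ℕ => Real.exp ((k + 1) * σ) * p k := by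
  refine Summable.of_nonneg_of_le (fun k => mul_nonneg (by positivity) (hp0 k)) (fun k => ?_)
    (summable_succ_mul_exp hσ)
  rw [mul_comm]
  exact mul_le_mul_of_nonneg_right ((hp1 k).trans (by simp)) (by positivity)

lemma hasDerivAt_tsum_exp_mul {p : ℕ → ℝ} (hp0 : ∀ k, 0 ≤ p k) (hp1 : ∀ k, p k ≤ 1)
    (hσ : σ < 0) :
    HasDerivAt (fun σ => ∑' k : ℕ, Real.exp ((k + 1) * σ) * p k)
      (∑' k : ℕ, (k + 1) * (Real.exp ((k + 1) * σ) * p k)) σ := by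
  have mem_Iio : σ ∈ Set.Iio (σ / 2) := Set.mem_Iio.2 (by linarith)
  refine hasDerivAt_tsum_of_isPreconnected
    (g := fun (k : ℕ) τ => Real.exp ((k + 1) * τ) * p k)
    (g' := fun (k : ℕ) τ => (k + 1) * (Real.exp ((k + 1) * τ) * p k))
    (summable_succ_mul_exp (σ := σ / 2) (by linarith)) isOpen_Iio
    (convex_Iio (σ / 2)).isPreconnected (fun k τ _ => ?_) (fun k τ hτ => ?_) mem_Iio
    (summable_exp_mul hp0 hp1 hσ) mem_Iio
  · have hasDerivAt_exp : HasDerivAt (fun τ => Real.exp (((k : ℝ) + 1) * τ))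
        (Real.exp ((k + 1) * τ) * (k + 1)) τ := by
      simpa using ((hasDerivAt_id τ).const_mul ((k : ℝ) + 1)).exp
    exact (hasDerivAt_exp.mul_const (p k)).congr_deriv (by ring)
  · have := hp0 k
    rw [Real.norm_of_nonneg (by positivity)]
    calc (k + 1) * (Real.exp ((k + 1) * τ) * p k)
        ≤ (k + 1) * (Real.exp ((k + 1) * (σ / 2)) * 1) := by
          gcongr
          exacts [(Set.mem_Iio.1 hτ).le, hp1 k]
      _ = (k + 1) * Real.exp ((k + 1) * (σ / 2)) := by rw [mul_one]

end ExpSeries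

lemma Admissible.notMem {C g : ℝ} {n : ℕ} {G : WeightedGraph V} {o : V} {z : Set V}
    (h : Admissible C g n G o z) (hn : n ≠ 0) : o ∉ z := fun ho =>
  hn (by simpa [G.truncDist_of_mem n ho] using (G.truncDist_of_le h.1).symm)

lemma Admissible.setWeight_le {C g : ℝ} {n : ℕ} {G : WeightedGraph V} {o : V} {z : Set V}
    (h : Admissible C g n G o z) : G.setWeight z ≤ ENNReal.ofReal (C * g ^ n) * G.vertexWeight o :=
  (ENNReal.div_le_iff (G.vertexWeight_ne_zero o) (G.vertexWeight_ne_top o)).1 h.2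

section Laplace

variable (G : WeightedGraph V) (z : Set V) (o : V)

/-- The Laplace transform `E_o exp (σ T)` of the hitting time of `z ∌ o`, for `σ < 0`. -/
def laplace (σ : ℝ) : ℝ := (G.hitGen z (ENNReal.ofReal (Real.exp σ)) o).toReal

variable {σ : ℝ}

lemma ofReal_exp_lt_one (hσ : σ < 0) : ENNReal.ofReal (Real.exp σ) < 1 :=
  ENNReal.ofReal_lt_one.2 (Real.exp_lt_one_iff.2 hσ)

lemma toReal_exp_pow_mul_hitProb (k : ℕ) (σ : ℝ) :
    (ENNReal.ofReal (Real.exp σ) ^ (k + 1) * G.hitProb z k o).toReal =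
      Real.exp ((k + 1) * σ) * (G.hitProb z k o).toReal := by
  rw [ENNReal.toReal_mul, ENNReal.toReal_pow, ENNReal.toReal_ofReal (Real.exp_pos σ).le,
    ← Real.exp_nat_mul, Nat.cast_succ]

lemma laplace_eq_tsum (σ : ℝ) :
    G.laplace z o σ = ∑' k : ℕ, Real.exp ((k + 1) * σ) * (G.hitProb z k o).toReal := by
  rw [laplace, hitGen, ENNReal.tsum_toReal_eq fun k =>
    ENNReal.mul_ne_top (by finiteness) (G.hitProb_ne_top z k o)]
  simp_rw [toReal_exp_pow_mul_hitProb]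

lemma toReal_hitGenDeriv (σ : ℝ) :
    (G.hitGenDeriv z (ENNReal.ofReal (Real.exp σ)) o).toReal =
      ∑' k : ℕ, (k + 1) * (Real.exp ((k + 1) * σ) * (G.hitProb z k o).toReal) := by
  rw [hitGenDeriv, ENNReal.tsum_toReal_eq fun k => ENNReal.mul_ne_top (by finiteness)
    (ENNReal.mul_ne_top (by finiteness) (G.hitProb_ne_top z k o))]
  refine tsum_congr fun k => ?_
  rw [ENNReal.toReal_mul, toReal_exp_pow_mul_hitProb]
  norm_cast

lemma toReal_hitProb_le_one (k : ℕ) : (G.hitProb z k o).toReal ≤ 1 :=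
  ENNReal.toReal_le_of_le_ofReal zero_le_one (by simpa using G.hitProb_le_one z k o)

lemma hasDerivAt_laplace (hσ : σ < 0) :
    HasDerivAt (G.laplace z o) (G.hitGenDeriv z (ENNReal.ofReal (Real.exp σ)) o).toReal σ := by
  rw [toReal_hitGenDeriv, funext (G.laplace_eq_tsum z o)]
  exact hasDerivAt_tsum_exp_mul (fun _ => ENNReal.toReal_nonneg) (G.toReal_hitProb_le_one z o) hσ

lemma laplace_nonneg (σ : ℝ) : 0 ≤ G.laplace z o σ := ENNReal.toReal_nonneg

lemma laplace_le_one (hσ : σ ≤ 0) : G.laplace z o σ ≤ 1 :=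
  ENNReal.toReal_le_of_le_ofReal zero_le_one <| by
    simpa using G.hitGen_le_one z (by simpa using hσ) o

lemma log_laplace_div_nonpos (hσ : σ ≤ 0) (n : ℕ) : Real.log (G.laplace z o σ) / n ≤ 0 :=
  div_nonpos_of_nonpos_of_nonneg
    (Real.log_nonpos (G.laplace_nonneg z o σ) (G.laplace_le_one z o hσ)) n.cast_nonneg

lemma ofReal_laplace (hσ : σ ≤ 0) :
    ENNReal.ofReal (G.laplace z o σ) = G.hitGen z (ENNReal.ofReal (Real.exp σ)) o :=
  ENNReal.ofReal_toReal <|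
    ne_top_of_le_ne_top ENNReal.one_ne_top (G.hitGen_le_one z (by simpa using hσ) o)

variable {G z o} in
lemma laplace_pos_of_laplace_ne_zero {τ : ℝ} (h : G.laplace z o τ ≠ 0) (hσ : σ < 0) :
    0 < G.laplace z o σ := by
  have nonneg (k : ℕ) : 0 ≤ (G.hitProb z k o).toReal := ENNReal.toReal_nonneg
  obtain ⟨k, hk⟩ : ∃ k, (G.hitProb z k o).toReal ≠ 0 := by
    by_contra! all_zero
    simp [laplace_eq_tsum, all_zero] at h
  rw [laplace_eq_tsum]
  exact (summable_exp_mul nonneg (G.toReal_hitProb_le_one z o) hσ).tsum_pos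
    (fun k => mul_nonneg (Real.exp_pos _).le (nonneg k)) k
    (mul_pos (Real.exp_pos _) ((nonneg k).lt_of_ne' hk))

end Laplace

section Comparison

variable {G : WeightedGraph V} {z : Set V} {o : V} {C g : ℝ} {n : ℕ} {σ : ℝ}

lemma Admissible.laplace_mul_le (h : Admissible C g n G o z) (hC : 1 ≤ C) (hg : 1 < g)
    (hn : 2 ≤ n) (hσ : σ < 0) (hpos : 0 < G.laplace z o σ) :
    G.laplace z o σ * (biasedSlowness (g * Real.exp (-(2 * (Real.log (G.laplace z o σ) / n)))) *
      (n - stepLoss C g)) ≤ (G.hitGenDeriv z (ENNReal.ofReal (Real.exp σ)) o).toReal := by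
  set F := G.laplace z o σ
  set γ := g * Real.exp (-(2 * (Real.log F / n))) with hγ
  have g_le : g ≤ γ := le_mul_exp_neg (by linarith) (G.log_laplace_div_nonpos z o hσ.le n)
  have log_eq : Real.log (C * g ^ n / F ^ 2) = Real.log C + n * Real.log γ := by
    have : (n : ℝ) ≠ 0 := by positivity
    rw [Real.log_div (by positivity) (by positivity), Real.log_mul (by positivity) (by positivity),
      Real.log_pow, Real.log_pow, hγ, Real.log_mul (by positivity) (by positivity), Real.log_exp]
    field_simp
    push_cast
    ring
  refine le_trans (mul_le_mul_of_nonneg_left ?_ hpos.le) (G.hitGen_mul_le_hitGenDeriv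
    (ofReal_exp_lt_one hσ) (hg.trans_le g_le) hn h.1 (by positivity) hpos h.setWeight_le rfl)
  rw [log_eq]
  exact biasedSlowness_mul_sub_stepLoss_le hC hg g_le n

lemma Admissible.logDiscount_log_laplace_le (h : Admissible C g n G o z) (hC : 1 ≤ C) (hg : 1 < g)
    (hn : 2 ≤ n) (hσ : σ < 0) (hne : G.laplace z o σ ≠ 0) :
    logDiscount g (Real.log (G.laplace z o σ) / n) ≤ (1 - stepLoss C g / n) * σ := by
  have hn0 : (0 : ℝ) < n := by positivity
  have hpos (τ : ℝ) (hτ : τ < 0) : 0 < G.laplace z o τ := laplace_pos_of_laplace_ne_zero hne hτ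
  refine logDiscount_comp_le (L := fun τ => Real.log (G.laplace z o τ) / n) hg
    (fun τ hτ => ((G.hasDerivAt_laplace z o hτ).log (hpos τ hτ).ne').div_const _)
    (fun τ hτ => G.log_laplace_div_nonpos z o hτ.le n) (fun τ hτ => ?_) hσ
  rw [le_div_iff₀ hn0, le_div_iff₀' (hpos τ hτ)]
  refine (Eq.le ?_).trans (h.laplace_mul_le hC hg hn hτ (hpos τ hτ))
  rw [one_sub_div hn0.ne', mul_assoc, div_mul_cancel₀ _ hn0.ne']

lemma Admissible.laplace_le {L : ℝ} (h : Admissible C g n G o z) (hC : 1 ≤ C) (hg : 1 < g)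
    (hn : 2 ≤ n) (hσ : σ < 0) (hL : L ≤ 0)
    (hσL : (1 - stepLoss C g / n) * σ ≤ logDiscount g L) :
    G.laplace z o σ ≤ Real.exp (n * L) := by
  rcases eq_or_ne (G.laplace z o σ) 0 with hzero | hne
  · exact hzero ▸ (Real.exp_pos _).le
  have log_le : Real.log (G.laplace z o σ) / n ≤ L :=
    ((strictMonoOn_logDiscount hg).le_iff_le (G.log_laplace_div_nonpos z o hσ.le n) hL).1
      ((h.logDiscount_log_laplace_le hC hg hn hσ hne).trans hσL)
  rwa [div_le_iff₀' (by positivity),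
    Real.log_le_iff_le_exp (laplace_pos_of_laplace_ne_zero hne hσ)] at log_le

end Comparison

section MeanLowerBound

lemma nonneg_of_hasDerivAt_of_forall_lt_le {f : ℝ → ℝ} {f' a : ℝ} (hf : HasDerivAt f f' a)
    (hle : ∀ x < a, f x ≤ f a) : 0 ≤ f' := by
  have isMax : IsLocalMaxOn f (Set.Iic a) a := by
    filter_upwards [self_mem_nhdsWithin] with x hx
    rcases (Set.mem_Iic.1 hx).eq_or_lt with rfl | hx
    exacts [le_rfl, hle x hx]
  have mem_cone : (-1 : ℝ) ∈ posTangentConeAt (Set.Iic a) a := by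
    refine mem_posTangentConeAt_of_segment_subset ((convex_Iic a).segment_subset ?_ ?_) <;> simp
  simpa using isMax.hasFDerivWithinAt_nonpos hf.hasFDerivAt.hasFDerivWithinAt mem_cone

variable {G : WeightedGraph V} {z : Set V} {o : V} {C g l : ℝ} {n : ℕ}

lemma one_sub_stepLoss_div_pos (hloss : stepLoss C g < n) : 0 < 1 - stepLoss C g / n := by
  rcases n.eq_zero_or_pos with rfl | hn
  · simp
  · rw [sub_pos, div_lt_one (by positivity)]
    exact hloss

lemma one_le_mul_natCast_add_pow (hl : 0 ≤ l) (k : ℕ) :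
    (1 : ℝ≥0∞) ≤ ENNReal.ofReal l * k + ENNReal.ofReal (Real.exp (-l)) ^ k := by
  rw [← ENNReal.ofReal_natCast, ← ENNReal.ofReal_mul hl, ← ENNReal.ofReal_pow (by positivity),
    ← ENNReal.ofReal_add (by positivity) (by positivity), ENNReal.one_le_ofReal,
    ← Real.exp_nat_mul]
  linarith [Real.add_one_le_exp ((k : ℝ) * -l)]

lemma one_le_mul_meanHit_add_hitGen (ho : o ∉ z) (hl : 0 < l) :
    1 ≤ ENNReal.ofReal l * G.meanHit o z + G.hitGen z (ENNReal.ofReal (Real.exp (-l))) o := by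
  have missProb_le : G.missProb z o ≤ ENNReal.ofReal l * (⊤ * G.missProb z o) := by
    rcases eq_or_ne (G.missProb z o) 0 with h | h
    · simp [h]
    · simp [h, ENNReal.top_mul, ENNReal.mul_top, hl]
  calc (1 : ℝ≥0∞) = G.missProb z o + ∑' k, G.hitProb z k o :=
        (tsub_add_cancel_of_le (G.tsum_hitProb_le_one z o)).symm
    _ ≤ ENNReal.ofReal l * (⊤ * G.missProb z o) + ∑' k : ℕ, (ENNReal.ofReal l * (k + 1 : ℕ) +
          ENNReal.ofReal (Real.exp (-l)) ^ (k + 1)) * G.hitProb z k o :=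
        add_le_add missProb_le (ENNReal.tsum_le_tsum fun k =>
          le_mul_of_one_le_left' (one_le_mul_natCast_add_pow hl.le (k + 1)))
    _ = _ := by
        simp_rw [meanHit, expectHit_eq G ho, hitGen, add_mul, ENNReal.tsum_add, mul_add,
          ← ENNReal.tsum_mul_left, add_assoc, ENat.toENNReal_top, ENat.toENNReal_coe, mul_assoc]

lemma mul_one_sub_exp_le {κ ν L : ℝ} (ho : o ∉ z) (hg : 1 < g) (hκ : 0 < κ)
    (hfin : G.meanHit o z ≠ ⊤) (hL : L < 0)
    (hle : G.hitGen z (ENNReal.ofReal (Real.exp (logDiscount g L / κ))) o ≤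
      ENNReal.ofReal (Real.exp (ν * L))) :
    κ * (1 - Real.exp (ν * L)) ≤ -logDiscount g L * (G.meanHit o z).toReal := by
  set σ := logDiscount g L / κ with hσ_def
  have hσ : 0 < -σ := neg_pos.2 (div_neg_of_neg_of_pos (logDiscount_neg hg hL) hκ)
  have one_le := one_le_mul_meanHit_add_hitGen (G := G) ho hσ
  rw [neg_neg] at one_le
  replace one_le := one_le.trans (add_le_add_right hle _)
  rw [← ENNReal.ofReal_toReal hfin, ← ENNReal.ofReal_mul hσ.le, ← ENNReal.ofReal_add
    (mul_nonneg hσ.le ENNReal.toReal_nonneg) (by positivity), ENNReal.one_le_ofReal] at one_le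
  calc κ * (1 - Real.exp (ν * L)) ≤ κ * (-σ * (G.meanHit o z).toReal) := by
        gcongr
        linarith
    _ = -logDiscount g L * (G.meanHit o z).toReal := by
        rw [hσ_def]
        field_simp

lemma le_meanHit_of_hitGen_le {κ ν : ℝ} (ho : o ∉ z) (hg : 1 < g) (hκ : 0 < κ)
    (hle : ∀ L < 0, G.hitGen z (ENNReal.ofReal (Real.exp (logDiscount g L / κ))) o ≤
      ENNReal.ofReal (Real.exp (ν * L))) :
    ENNReal.ofReal (biasedSlowness g * (κ * ν)) ≤ G.meanHit o z := by
  rcases eq_or_ne (G.meanHit o z) ⊤ with htop | hfin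
  · exact htop ▸ le_top
  have hasDerivAt_exp : HasDerivAt (fun L => Real.exp (ν * L)) ν 0 := by
    simpa using ((hasDerivAt_id (0 : ℝ)).const_mul ν).exp
  have hasDerivAt_logDiscount_zero : HasDerivAt (logDiscount g) (biasedSlowness g)⁻¹ 0 := by
    simpa using hasDerivAt_logDiscount (by linarith : 0 < g) 0
  have deriv_nonneg : 0 ≤ (biasedSlowness g)⁻¹ * (G.meanHit o z).toReal + κ * -ν :=
    nonneg_of_hasDerivAt_of_forall_lt_le
      ((hasDerivAt_logDiscount_zero.mul_const _).add ((hasDerivAt_exp.const_sub 1).const_mul κ))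
      fun L hL => by
        have := mul_one_sub_exp_le ho hg hκ hfin hL (hle L hL)
        simp only [Pi.add_apply, logDiscount_zero, mul_zero, Real.exp_zero, sub_self, zero_mul]
        linarith
  rw [ENNReal.ofReal_le_iff_le_toReal hfin,
    ← le_inv_mul_iff₀ (zero_lt_one.trans_le (one_le_biasedSlowness hg))]
  linarith

lemma Admissible.hitGen_le (h : Admissible C g n G o z) (hC : 1 ≤ C) (hg : 1 < g) (hn : 2 ≤ n)
    (hloss : stepLoss C g < n) {L : ℝ} (hL : L < 0) :
    G.hitGen z (ENNReal.ofReal (Real.exp (logDiscount g L / (1 - stepLoss C g / n)))) o ≤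
      ENNReal.ofReal (Real.exp (n * L)) := by
  have hκ : 0 < 1 - stepLoss C g / n := one_sub_stepLoss_div_pos hloss
  have hσ := div_neg_of_neg_of_pos (logDiscount_neg hg hL) hκ
  rw [← G.ofReal_laplace z o hσ.le]
  exact ENNReal.ofReal_le_ofReal
    (h.laplace_le hC hg hn hσ hL.le (mul_div_cancel₀ _ hκ.ne').le)

lemma Admissible.le_meanHit (h : Admissible C g n G o z) (hC : 1 ≤ C) (hg : 1 < g) (hn : 2 ≤ n) :
    ENNReal.ofReal (biasedSlowness g * (n - stepLoss C g)) ≤ G.meanHit o z := by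
  rcases le_or_gt (n : ℝ) (stepLoss C g) with hloss | hloss
  · rw [ENNReal.ofReal_of_nonpos (mul_nonpos_of_nonneg_of_nonpos
      (zero_le_one.trans (one_le_biasedSlowness hg)) (sub_nonpos.2 hloss))]
    exact zero_le
  refine (Eq.le ?_).trans (le_meanHit_of_hitGen_le (h.notMem (by omega)) hg
    (one_sub_stepLoss_div_pos hloss) fun L hL => h.hitGen_le hC hg hn hloss hL)
  rw [sub_mul, one_mul, div_mul_cancel₀ _ (by positivity)]

end MeanLowerBound

section ComparisonPrinciple

variable (G : WeightedGraph V) {z : Set V} {s : ℝ≥0∞} {f h : V → ℝ≥0∞}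

lemma pow_mul_killed_iterate_add (z : Set V) (s : ℝ≥0∞) (f h : V → ℝ≥0∞) (k : ℕ) (x : V) :
    s ^ k * (G.killed z)^[k] (f + fun y => s * G.killed z h y) x =
      s ^ k * (G.killed z)^[k] f x + s ^ (k + 1) * (G.killed z)^[k + 1] h x := by
  rw [killed_iterate_add, killed_iterate_const_mul, Pi.add_apply, Function.iterate_succ_apply,
    pow_succ]
  ring

lemma green_le (hle : ∀ x, f x + s * G.killed z h x ≤ h x) (x : V) : G.green z s f x ≤ h x := by
  have partial_le (K : ℕ) : ∑ k ∈ Finset.range K, s ^ k * (G.killed z)^[k] f x +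
      s ^ K * (G.killed z)^[K] h x ≤ h x := by
    induction K with
    | zero => simp
    | succ K ih =>
      rw [Finset.sum_range_succ, add_assoc, ← pow_mul_killed_iterate_add]
      exact le_trans (by gcongr; exact (G.monotone_killed z).iterate K hle x) ih
  rw [green, ENNReal.tsum_eq_iSup_nat]
  exact iSup_le fun K => le_self_add.trans (partial_le K)

lemma le_green (hs : s < 1) (hh : h ≤ 1) (hle : ∀ x, h x ≤ f x + s * G.killed z h x) (x : V) :
    h x ≤ G.green z s f x := by
  have le_partial (K : ℕ) : h x ≤ ∑ k ∈ Finset.range K, s ^ k * (G.killed z)^[k] f x +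
      s ^ K * (G.killed z)^[K] h x := by
    induction K with
    | zero => simp
    | succ K ih =>
      rw [Finset.sum_range_succ, add_assoc, ← pow_mul_killed_iterate_add]
      refine ih.trans ?_
      gcongr
      exact (G.monotone_killed z).iterate K hle x
  have le_add_pow (K : ℕ) : h x ≤ G.green z s f x + s ^ K :=
    (le_partial K).trans (add_le_add (ENNReal.sum_le_tsum _) (mul_le_of_le_one_right'
      (((G.monotone_killed z).iterate K hh x).trans (G.killed_iterate_one_le_one z K x))))
  have limit := (tendsto_const_nhds (x := G.green z s f x)).add
    (ENNReal.tendsto_pow_atTop_nhds_zero_of_lt_one hs)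
  rw [add_zero] at limit
  exact ge_of_tendsto' limit le_add_pow

lemma meanHit_le {o : V} (ho : o ∉ z) (hle : ∀ x, 1 + G.killed z h x ≤ h x) :
    G.meanHit o z ≤ h o := by
  have meanHit_eq_green : G.meanHit o z = G.green z 1 1 o := by simp [G.meanHit_eq ho, green]
  exact meanHit_eq_green ▸ G.green_le (by simpa using hle) o

lemma hitGen_eq_green (s : ℝ≥0∞) (x : V) :
    G.hitGen z s x = G.green z s (fun y => s * G.enter z y) x := by
  simp_rw [hitGen_eq_mul_green, green, killed_iterate_const_mul, ← ENNReal.tsum_mul_left,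
    mul_left_comm]

lemma hitGen_le (hle : ∀ x, s * (G.enter z x + G.killed z h x) ≤ h x) (x : V) :
    G.hitGen z s x ≤ h x :=
  hitGen_eq_green G s x ▸ G.green_le (fun x => mul_add s _ _ ▸ hle x) x

lemma le_hitGen (hs : s < 1) (hh : h ≤ 1) (hle : ∀ x, h x ≤ s * (G.enter z x + G.killed z h x))
    (x : V) : h x ≤ G.hitGen z s x :=
  hitGen_eq_green G s x ▸ G.le_green hs hh (fun x => mul_add s _ _ ▸ hle x) x

variable (z) in
lemma killed_sum {ι : Type*} (t : Finset ι) (f : ι → V → ℝ≥0∞) (x : V) :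
    G.killed z (fun y => ∑ i ∈ t, f i y) x = ∑ i ∈ t, G.killed z (f i) x := by
  classical
  induction t using Finset.induction_on with
  | empty => simp [killed]
  | insert i t hi ih =>
    simp_rw [Finset.sum_insert hi, ← ih]
    exact congrFun (G.killed_add z _ _) x

variable (z) in
lemma sum_hitProb_succ (k : ℕ) (x : V) :
    ∑ i ∈ Finset.range (k + 1), G.hitProb z i x =
      G.enter z x + G.killed z (fun y => ∑ i ∈ Finset.range k, G.hitProb z i y) x := by
  rw [killed_sum, Finset.sum_range_succ', add_comm]
  simp only [hitProb, Function.iterate_succ_apply', Function.iterate_zero, id]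
  rfl

end ComparisonPrinciple

/-- The graph whose vertices are relabelled along a bijection. -/
def comap {W : Type*} (e : V ≃ W) (G : WeightedGraph W) : WeightedGraph V where
  weight x y := G.weight (e x) (e y)
  symm _ _ := G.symm _ _
  total_ne_zero x := by
    rw [e.tsum_eq (G.weight (e x))]
    exact G.total_ne_zero _
  total_ne_top x := by
    rw [e.tsum_eq (G.weight (e x))]
    exact G.total_ne_top _

section Line

variable {g : ℝ} (hg : 1 < g) (e : V ≃ ℤ)

lemma tsum_biasedWeight_mul (g : ℝ) (i : ℤ) (h : ℤ → ℝ≥0∞) :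
    ∑' j, biasedWeight g i j * h j = ENNReal.ofReal (g ^ i) * h (i + 1) +
      ENNReal.ofReal (g ^ (i - 1)) * h (i - 1) := by
  rw [tsum_eq_sum (s := {i + 1, i - 1})]
  · rw [Finset.sum_pair (by omega)]
    simp [biasedWeight, show i - 1 ≠ i + 1 by omega]
  · intro j hj
    simp only [Finset.mem_insert, Finset.mem_singleton, not_or] at hj
    rw [biasedWeight, if_neg hj.1, if_neg (by omega), zero_mul]

lemma vertexWeight_line (x : V) :
    ((biasedLine g hg).comap e).vertexWeight x = ENNReal.ofReal (g ^ (e x - 1) * (g + 1)) := by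
  have hg0 : 0 < g := by linarith
  have total := tsum_biasedWeight_mul g (e x) 1
  simp only [Pi.one_apply, mul_one] at total
  refine (e.tsum_eq (biasedWeight g (e x))).trans (total.trans ?_)
  rw [← ENNReal.ofReal_add (by positivity) (by positivity), mul_add, mul_one,
    zpow_sub_one₀ hg0.ne', inv_mul_cancel_right₀ hg0.ne']

lemma tsum_step_mul_line (x : V) (h : ℤ → ℝ≥0∞) :
    ∑' y, ((biasedLine g hg).comap e).step x y * h (e y) =
      ENNReal.ofReal (g / (g + 1)) * h (e x + 1) +
        ENNReal.ofReal (1 - g / (g + 1)) * h (e x - 1) := by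
  have hg0 : 0 < g := by linarith
  have weighted : ∑' y, ((biasedLine g hg).comap e).weight x y * h (e y) = _ :=
    (e.tsum_eq fun j => biasedWeight g (e x) j * h j).trans (tsum_biasedWeight_mul g (e x) h)
  simp_rw [step_apply, div_eq_mul_inv, mul_right_comm _ _ (h (e _))]
  rw [ENNReal.tsum_mul_right, weighted, vertexWeight_line, add_mul, mul_right_comm,
    mul_right_comm _ (h (e x - 1)), ← ENNReal.ofReal_inv_of_pos (by positivity),
    ← ENNReal.ofReal_mul (by positivity), ← ENNReal.ofReal_mul (by positivity)]
  congr 3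
  · rw [zpow_sub_one₀ hg0.ne']
    field_simp
  · field_simp
    ring

variable {N : ℤ} {h : V → ℝ≥0∞} {φ : ℤ → ℝ≥0∞}

lemma mul_enter_add_killed_line (hh : ∀ y, e y < N → h y = φ (e y)) {x : V} (hx : e x < N) :
    φ N * ((biasedLine g hg).comap e).enter {e.symm N} x +
        ((biasedLine g hg).comap e).killed {e.symm N} h x =
      ENNReal.ofReal (g / (g + 1)) * φ (e x + 1) +
        ENNReal.ofReal (1 - g / (g + 1)) * φ (e x - 1) := by
  have boundary (y : V) : φ N * ({e.symm N} : Set V).indicator 1 y +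
      ({e.symm N} : Set V)ᶜ.indicator h y = if e y = N then φ N else h (e.symm (e y)) := by
    rcases eq_or_ne (e y) N with hy | hy
    · simp [← hy]
    · simp [hy, Equiv.eq_symm_apply]
  have inside {i : ℤ} (hi : i ≤ N) : (if i = N then φ N else h (e.symm i)) = φ i := by
    split_ifs with hiN
    · rw [hiN]
    · simpa using hh (e.symm i) (by simpa using lt_of_le_of_ne hi hiN)
  rw [enter, killed, ← ENNReal.tsum_mul_left, ← ENNReal.tsum_add]
  simp_rw [mul_left_comm (φ N), ← mul_add, boundary]
  rw [tsum_step_mul_line hg e x fun i => if i = N then φ N else h (e.symm i), inside (by omega),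
    inside (by omega)]

lemma meanHit_line_le {x : V} (hx : e x < N) :
    ((biasedLine g hg).comap e).meanHit x {e.symm N} ≤
      ENNReal.ofReal (biasedSlowness g * (N - e x)) := by
  have hm := one_le_biasedSlowness hg
  have hp : 0 ≤ g / (g + 1) := by positivity
  have hq : 0 ≤ 1 - g / (g + 1) := by
    rw [sub_nonneg, div_le_one (by linarith)]
    linarith
  set φ : ℤ → ℝ≥0∞ := fun i => ENNReal.ofReal (biasedSlowness g * (N - i)) with hφ
  have hx_notMem : x ∉ ({e.symm N} : Set V) := by
    rintro rfl
    simp at hx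
  refine (meanHit_le _ hx_notMem (h := fun y => if e y < N then φ (e y) else ⊤)
    fun y => ?_).trans_eq (if_pos hx)
  split_ifs with hy
  swap
  · exact le_top
  have killed_eq := mul_enter_add_killed_line hg e (φ := φ)
    (h := fun y => if e y < N then φ (e y) else ⊤) (fun y hy => if_pos hy) hy
  have hy' : (0 : ℝ) ≤ N - (e y + 1) := by
    have : ((e y + 1 : ℤ) : ℝ) ≤ N := by exact_mod_cast hy
    push_cast at this
    linarith
  rw [show φ N = 0 by simp [hφ], zero_mul, zero_add] at killed_eq
  rw [killed_eq]
  simp only [hφ, Int.cast_add, Int.cast_sub, Int.cast_one]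
  rw [← ENNReal.ofReal_mul hp, ← ENNReal.ofReal_mul hq, ← ENNReal.ofReal_one,
    ← ENNReal.ofReal_add (mul_nonneg hp (by positivity))
      (mul_nonneg hq (mul_nonneg (by linarith) (by linarith))),
    ← ENNReal.ofReal_add zero_le_one (add_nonneg (mul_nonneg hp (by positivity))
      (mul_nonneg hq (mul_nonneg (by linarith) (by linarith))))]
  refine ENNReal.ofReal_le_ofReal (le_of_eq ?_)
  have : g - 1 ≠ 0 := by linarith
  unfold biasedSlowness
  field_simp
  ring

lemma exp_logDiscount (hg : 0 < g) (L : ℝ) :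
    Real.exp (logDiscount g L) = (g + 1) * Real.exp L / (g + Real.exp L ^ 2) := by
  rw [logDiscount, Real.exp_sub, Real.exp_add, Real.exp_log (by positivity),
    Real.exp_log (by positivity), ← Real.exp_nat_mul, Nat.cast_ofNat]

lemma exp_logDiscount_mul (hg : 0 < g) (L y : ℝ) :
    Real.exp (logDiscount g L) * (g / (g + 1) * Real.exp (L * (y - 1)) +
      (1 - g / (g + 1)) * Real.exp (L * (y + 1))) = Real.exp (L * y) := by
  have := Real.exp_pos L
  rw [exp_logDiscount hg, mul_sub L, mul_add L, mul_one, Real.exp_sub, Real.exp_add]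
  field_simp
  ring

lemma hitGen_line {x : V} (hx : e x < N) {L : ℝ} (hL : L < 0) :
    ((biasedLine g hg).comap e).hitGen {e.symm N} (ENNReal.ofReal (Real.exp (logDiscount g L))) x =
      ENNReal.ofReal (Real.exp (L * (N - e x))) := by
  have hp : 0 ≤ g / (g + 1) := by positivity
  have hq : 0 ≤ 1 - g / (g + 1) := by
    rw [sub_nonneg, div_le_one (by linarith)]
    linarith
  set s := ENNReal.ofReal (Real.exp (logDiscount g L)) with hs
  set φ : ℤ → ℝ≥0∞ := fun i => ENNReal.ofReal (Real.exp (L * (N - i))) with hφ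
  have harmonic (i : ℤ) : s * (ENNReal.ofReal (g / (g + 1)) * φ (i + 1) +
      ENNReal.ofReal (1 - g / (g + 1)) * φ (i - 1)) = φ i := by
    simp only [hφ]
    rw [← ENNReal.ofReal_mul hp, ← ENNReal.ofReal_mul hq, ← ENNReal.ofReal_add (by positivity)
      (mul_nonneg hq (by positivity)), hs, ← ENNReal.ofReal_mul (by positivity),
      ← exp_logDiscount_mul (g := g) (by linarith) L ((N : ℝ) - i)]
    push_cast
    ring_nf
  have solves {h : V → ℝ≥0∞} (hh : ∀ y, e y < N → h y = φ (e y)) {y : V} (hy : e y < N) :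
      s * (((biasedLine g hg).comap e).enter {e.symm N} y +
        ((biasedLine g hg).comap e).killed {e.symm N} h y) = φ (e y) := by
    have := mul_enter_add_killed_line hg e hh hy
    rw [show φ N = 1 by simp [hφ], one_mul] at this
    rw [this, harmonic]
  refine le_antisymm
    ((hitGen_le _ (h := fun y => if e y < N then φ (e y) else ⊤) (fun y => ?_) x).trans_eq
      (if_pos hx))
    ((if_pos hx).symm.trans_le (le_hitGen _ (h := fun y => if e y < N then φ (e y) else 0)
      (ofReal_exp_lt_one (logDiscount_neg hg hL)) (fun y => ?_) (fun y => ?_) x))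
  · split_ifs with hy
    exacts [(solves (fun y hy => if_pos hy) hy).le, le_top]
  · dsimp only
    split_ifs with hy
    · have : (e y : ℝ) < N := by exact_mod_cast hy
      exact ENNReal.ofReal_le_one.2 (Real.exp_le_one_iff.2 (by nlinarith))
    · exact zero_le
  · split_ifs with hy
    exacts [(solves (fun y hy => if_pos hy) hy).ge, zero_le]

lemma edist_line_ge (x y : V) (k : ℕ) (hk : e x + k ≤ e y) :
    (k : ℕ∞) ≤ ((biasedLine g hg).comap e).toSimpleGraph.edist x y := by
  have le_add_length {x y : V} (p : ((biasedLine g hg).comap e).toSimpleGraph.Walk x y) :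
      e y ≤ e x + p.length := by
    induction p with
    | nil => simp
    | @cons a b _ hab p ih =>
      have step_le : e b ≤ e a + 1 := by
        have weight_ne_zero : biasedWeight g (e a) (e b) ≠ 0 := hab.2
        rw [biasedWeight] at weight_ne_zero
        split_ifs at weight_ne_zero <;> first | omega | exact absurd rfl weight_ne_zero
      rw [SimpleGraph.Walk.length_cons]
      push_cast
      linarith
  refine le_iInf fun p => ?_
  have := le_add_length p
  exact_mod_cast (by omega : k ≤ p.length)

lemma admissible_line {C : ℝ} (hC : 1 ≤ C) (n : ℕ) :
    Admissible C g n ((biasedLine g hg).comap e) (e.symm 0) {e.symm n} := by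
  have hg0 : 0 < g := by linarith
  refine ⟨by simpa [distToSet] using edist_line_ge hg e (e.symm 0) (e.symm n) n (by simp), ?_⟩
  rw [setWeight, tsum_singleton (e.symm (n : ℤ)) ((biasedLine g hg).comap e).vertexWeight,
    vertexWeight_line, vertexWeight_line, ← ENNReal.ofReal_div_of_pos (by positivity)]
  refine ENNReal.ofReal_le_ofReal ?_
  calc g ^ (e (e.symm n) - 1) * (g + 1) / (g ^ (e (e.symm 0) - 1) * (g + 1)) = 1 * g ^ n := by
        rw [Equiv.apply_symm_apply, Equiv.apply_symm_apply, mul_div_mul_right _ _ (by positivity),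
          ← zpow_sub₀ hg0.ne', sub_sub_sub_cancel_right, sub_zero, zpow_natCast, one_mul]
    _ ≤ C * g ^ n := by gcongr

end Line

section StartInTarget

variable (G : WeightedGraph V) {z : Set V} {o : V}

lemma ae_hitTime_eq_zero [MeasurableSpace V] [DiscreteMeasurableSpace V] (ho : o ∈ z) :
    ∀ᵐ ω ∂G.walkLaw o, hitTime z ω = 0 := by
  have measurable_indicator : Measurable fun ω : ℕ → V => zᶜ.indicator (1 : V → ℝ≥0∞) (ω 0) :=
    (Measurable.of_discrete (f := zᶜ.indicator (1 : V → ℝ≥0∞))).comp (measurable_pi_apply 0)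
  have lintegral_eq_zero := G.lintegral_walkLaw_zero o (zᶜ.indicator 1)
  rw [Set.indicator_of_notMem (by simpa using ho), lintegral_eq_zero_iff measurable_indicator]
    at lintegral_eq_zero
  filter_upwards [lintegral_eq_zero] with ω hω
  exact nonpos_iff_eq_zero.1 (iInf₂_le 0 (by simpa using hω))

lemma expectHit_of_mem (ho : o ∈ z) (F : ℕ∞ → ℝ≥0∞) : G.expectHit o z F = F 0 := by
  let _ : MeasurableSpace V := ⊤
  have : DiscreteMeasurableSpace V := ⟨fun _ => trivial⟩
  rw [expectHit, lintegral_congr_ae (g := fun _ => F 0)]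
  · simp
  · filter_upwards [G.ae_hitTime_eq_zero ho] with ω hω
    rw [hω]

lemma probHitLE_of_mem (ho : o ∈ z) {t : ℝ} (ht : 0 ≤ t) : G.probHitLE o z t = 1 := by
  let _ : MeasurableSpace V := ⊤
  have : DiscreteMeasurableSpace V := ⟨fun _ => trivial⟩
  refine (measure_congr (eventuallyEq_univ.2 ?_)).trans measure_univ
  filter_upwards [G.ae_hitTime_eq_zero ho] with ω hω
  simpa [hω] using ht

end StartInTarget

lemma probHitLE_le_one (G : WeightedGraph V) (o : V) (z : Set V) (t : ℝ) :
    G.probHitLE o z t ≤ 1 := by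
  let _ : MeasurableSpace V := ⊤
  have : DiscreteMeasurableSpace V := ⟨fun _ => trivial⟩
  exact prob_le_one

lemma probHitLE_le (G : WeightedGraph V) {z : Set V} {o : V} (ho : o ∉ z) {t σ : ℝ} (ht : 0 ≤ t)
    (hσ : σ ≤ 0) :
    G.probHitLE o z t ≤ ENNReal.ofReal (Real.exp (-(σ * t))) *
      G.hitGen z (ENNReal.ofReal (Real.exp σ)) o := by
  rw [G.probHitLE_eq ho ht, hitGen, ← ENNReal.tsum_mul_left]
  refine (Finset.sum_le_sum fun k hk => ?_).trans (ENNReal.sum_le_tsum (Finset.range ⌊t⌋₊))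
  rw [← mul_assoc, ← ENNReal.ofReal_pow (by positivity), ← ENNReal.ofReal_mul (by positivity),
    ← Real.exp_nat_mul, ← Real.exp_add]
  refine le_mul_of_one_le_left' (ENNReal.one_le_ofReal.2 (Real.one_le_exp ?_))
  have le_t : ((k + 1 : ℕ) : ℝ) ≤ t := (Nat.le_floor_iff ht).1 (Finset.mem_range.1 hk)
  linarith [mul_le_mul_of_nonpos_right le_t hσ]

section Extremal

variable {C g : ℝ} {n : ℕ}

lemma infMeanHit_le (hC : 1 ≤ C) (hg : 1 < g) (n : ℕ) :
    infMeanHit.{u} C g n ≤ ENNReal.ofReal (biasedSlowness g * n) := by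
  refine iInf_le_of_le _ <| iInf_le_of_le _ <| iInf_le_of_le _ <| iInf_le_of_le _ <|
    iInf_le_of_le (admissible_line hg Equiv.ulift.{u} hC n) ?_
  rcases n.eq_zero_or_pos with rfl | hn
  · rw [meanHit, expectHit_of_mem _ (by simp)]
    simp
  · exact (meanHit_line_le hg Equiv.ulift.{u} (by simpa using hn)).trans (by simp)

lemma le_infMeanHit (hC : 1 ≤ C) (hg : 1 < g) (hn : 2 ≤ n) :
    ENNReal.ofReal (biasedSlowness g * (n - stepLoss C g)) ≤ infMeanHit.{u} C g n :=
  le_iInf fun _ => le_iInf fun _ => le_iInf fun _ => le_iInf fun _ => le_iInf fun h =>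
    h.le_meanHit hC hg hn

lemma supProbHitLE_le_one (C g : ℝ) (n : ℕ) (t : ℝ) : supProbHitLE.{u} C g n t ≤ 1 :=
  iSup_le fun _ => iSup_le fun G => iSup_le fun o => iSup_le fun z => iSup_le fun _ =>
    G.probHitLE_le_one o z t

lemma probHitLE_line_le_supProbHitLE (hC : 1 ≤ C) (hg : 1 < g) (n : ℕ) (t : ℝ) :
    ((biasedLine g hg).comap Equiv.ulift.{u}).probHitLE (Equiv.ulift.symm 0)
      {Equiv.ulift.symm (n : ℤ)} t ≤ supProbHitLE.{u} C g n t :=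
  le_iSup_of_le _ <| le_iSup_of_le _ <| le_iSup_of_le _ <| le_iSup_of_le _ <|
    le_iSup_of_le (admissible_line hg Equiv.ulift.{u} hC n) le_rfl

lemma supProbHitLE_le (hC : 1 ≤ C) (hg : 1 < g) (hn : 2 ≤ n) (hloss : stepLoss C g < n)
    {a L : ℝ} (ha : 0 ≤ a) (hL : L < 0) :
    supProbHitLE.{u} C g n (a * n) ≤
      ENNReal.ofReal (Real.exp ((L - a * (logDiscount g L / (1 - stepLoss C g / n))) * n)) := by
  have hσ : logDiscount g L / (1 - stepLoss C g / n) < 0 :=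
    div_neg_of_neg_of_pos (logDiscount_neg hg hL) (one_sub_stepLoss_div_pos hloss)
  refine iSup_le fun V => iSup_le fun G => iSup_le fun o => iSup_le fun z => iSup_le fun h => ?_
  refine (G.probHitLE_le (h.notMem (by omega)) (by positivity) hσ.le).trans
    ((mul_le_mul_right (h.hitGen_le hC hg hn hloss hL) _).trans_eq ?_)
  rw [← ENNReal.ofReal_mul (by positivity), ← Real.exp_add]
  ring_nf

end Extremal

@[simp]
lemma comap_refl (G : WeightedGraph V) : comap (Equiv.refl V) G = G := rfl

section Jensen

variable {l m : ℝ}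

lemma ereal_exp_mul_natCast (l : ℝ) (k : ℕ) :
    EReal.exp ((l : EReal) * ((((k : ℕ) : ℕ∞) : ℝ≥0∞) : EReal)) =
      ENNReal.ofReal (Real.exp l) ^ k := by
  have coe_natCast : ((k : ℝ≥0∞) : EReal) = (k : EReal) := by
    rw [← ENNReal.ofReal_natCast, EReal.coe_ennreal_ofReal, max_eq_left (Nat.cast_nonneg k)]
    rfl
  rw [mul_comm, ← EReal.exp_coe, ← EReal.exp_nmul, ENat.toENNReal_coe, coe_natCast]

lemma exp_mul_add_mul_le (hl : 0 ≤ l) (hm : 0 ≤ m) (t : ℕ∞) :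
    ENNReal.ofReal (Real.exp (l * m)) +
        ENNReal.ofReal (Real.exp (l * m) * l) * ((t : ℝ≥0∞)) ≤
      EReal.exp ((l : EReal) * ((t : ℝ≥0∞) : EReal)) +
        ENNReal.ofReal (Real.exp (l * m) * (l * m)) := by
  induction t using ENat.recTopCoe with
  | top =>
    rcases hl.eq_or_lt with rfl | hl
    · simp
    · simp [EReal.coe_mul_top_of_pos hl]
  | coe k =>
    rw [ereal_exp_mul_natCast, ENat.toENNReal_coe, ← ENNReal.ofReal_natCast,
      ← ENNReal.ofReal_pow (by positivity), ← ENNReal.ofReal_mul (by positivity),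
      ← ENNReal.ofReal_add (by positivity) (by positivity),
      ← ENNReal.ofReal_add (by positivity) (by positivity), ← Real.exp_nat_mul]
    refine ENNReal.ofReal_le_ofReal ?_
    calc Real.exp (l * m) + Real.exp (l * m) * l * k
        = Real.exp (l * m) * (k * l - l * m + 1) + Real.exp (l * m) * (l * m) := by ring
      _ ≤ Real.exp (l * m) * Real.exp (k * l - l * m) + Real.exp (l * m) * (l * m) := by
          gcongr
          exact Real.add_one_le_exp _
      _ = Real.exp (k * l) + Real.exp (l * m) * (l * m) := by
          rw [← Real.exp_add, add_sub_cancel]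

lemma exp_mul_toReal_meanHit_le (G : WeightedGraph V) {o : V} {z : Set V} (hl : 0 ≤ l)
    (hfin : G.meanHit o z ≠ ⊤) :
    ENNReal.ofReal (Real.exp (l * (G.meanHit o z).toReal)) ≤
      G.expectHit o z fun t => EReal.exp ((l : EReal) * ((t : ℝ≥0∞) : EReal)) := by
  let _ : MeasurableSpace V := ⊤
  have : DiscreteMeasurableSpace V := ⟨fun _ => trivial⟩
  set m := (G.meanHit o z).toReal
  have measurable_comp (F : ℕ∞ → ℝ≥0∞) : Measurable fun ω : ℕ → V => F (hitTime z ω) :=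
    (Measurable.of_discrete (f := F)).comp (measurable_hitTime z)
  have integrated := lintegral_mono (μ := G.walkLaw o) fun ω =>
    exp_mul_add_mul_le hl (m := m) ENNReal.toReal_nonneg (hitTime z ω)
  rw [lintegral_add_left measurable_const,
    lintegral_const_mul _ (measurable_comp fun t => (t : ℝ≥0∞)),
    lintegral_add_right _ measurable_const, lintegral_const, lintegral_const, measure_univ,
    mul_one, mul_one] at integrated
  have slope_eq : ENNReal.ofReal (Real.exp (l * m) * l) * G.meanHit o z =
      ENNReal.ofReal (Real.exp (l * m) * (l * m)) := by
    rw [← ENNReal.ofReal_toReal hfin, ← ENNReal.ofReal_mul (by positivity), mul_assoc]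
  exact (ENNReal.add_le_add_iff_right ENNReal.ofReal_ne_top).1
    ((add_le_add_right slope_eq.ge _).trans integrated)

end Jensen

section Rate

variable {g : ℝ}

lemma hitGen_biasedLine (hg : 1 < g) {L : ℝ} (hL : L < 0) :
    (biasedLine g hg).hitGen {1} (ENNReal.ofReal (Real.exp (logDiscount g L))) 0 =
      ENNReal.ofReal (Real.exp L) := by
  simpa using hitGen_line hg (Equiv.refl ℤ) (N := 1) (x := 0) (by simp) hL

lemma meanHit_biasedLine (hg : 1 < g) :
    (biasedLine g hg).meanHit 0 {1} = ENNReal.ofReal (biasedSlowness g) := by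
  refine le_antisymm ?_ ?_
  · simpa using meanHit_line_le hg (Equiv.refl ℤ) (N := 1) (x := 0) (by simp)
  · simpa using le_meanHit_of_hitGen_le (G := biasedLine g hg) (z := {1}) (o := 0) (κ := 1)
      (ν := 1) (by simp) hg one_pos fun L hL => by simpa using (hitGen_biasedLine hg hL).le

lemma biasedMean_eq (hg : 1 < g) : biasedMean g hg = biasedSlowness g := by
  rw [biasedMean, meanHit_biasedLine,
    ENNReal.toReal_ofReal (zero_le_one.trans (one_le_biasedSlowness hg))]

lemma biasedLogMGF_logDiscount (hg : 1 < g) {L : ℝ} (hL : L < 0) :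
    biasedLogMGF g hg (logDiscount g L) = L := by
  have exp_mul_top : EReal.exp ((logDiscount g L : EReal) * (((⊤ : ℕ∞) : ℝ≥0∞) : EReal)) = 0 := by
    simp [EReal.coe_mul_top_of_neg (logDiscount_neg hg hL)]
  rw [biasedLogMGF, expectHit_eq _ (by simp), exp_mul_top, zero_mul, zero_add]
  simp_rw [ereal_exp_mul_natCast]
  rw [← hitGen, hitGen_biasedLine hg hL, ENNReal.log_ofReal_of_pos (Real.exp_pos _), Real.log_exp]

lemma mul_biasedMean_le_biasedLogMGF (hg : 1 < g) {l : ℝ} (hl : 0 ≤ l) :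
    ((l * biasedMean g hg : ℝ) : EReal) ≤ biasedLogMGF g hg l := by
  have := ENNReal.log_monotone <| exp_mul_toReal_meanHit_le (biasedLine g hg) hl
    (meanHit_biasedLine hg ▸ ENNReal.ofReal_ne_top)
  rwa [ENNReal.log_ofReal_of_pos (Real.exp_pos _), Real.log_exp] at this

lemma exists_logDiscount_eq (hg : 1 < g) {l : ℝ} (hl : l < 0) : ∃ L < 0, logDiscount g L = l := by
  have continuous_logDiscount : Continuous (logDiscount g) := continuous_iff_continuousAt.2
    fun L => (hasDerivAt_logDiscount (by linarith) L).continuousAt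
  have logDiscount_le (L : ℝ) : logDiscount g L ≤ L + (Real.log (g + 1) - Real.log g) := by
    have : Real.log g ≤ Real.log (g + Real.exp (2 * L)) :=
      Real.log_le_log (by linarith) (by linarith [Real.exp_pos (2 * L)])
    unfold logDiscount
    linarith
  set L₀ := l - (Real.log (g + 1) - Real.log g) with hL₀
  have L₀_nonpos : L₀ ≤ 0 := by
    linarith [Real.log_le_log (by linarith : 0 < g) (by linarith : g ≤ g + 1)]
  obtain ⟨L, hL, rfl⟩ := intermediate_value_Icc L₀_nonpos continuous_logDiscount.continuousOn
    ⟨(logDiscount_le L₀).trans_eq (sub_add_cancel _ _), (logDiscount_zero g).symm ▸ hl.le⟩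
  refine ⟨L, hL.2.lt_of_ne ?_, rfl⟩
  rintro rfl
  exact hl.ne (logDiscount_zero g)

/-- The point at which the Legendre transform of `logDiscount g`, in the form
`sup_L (a * logDiscount g L - L)`, is attained. -/
def optExponent (g a : ℝ) : ℝ := Real.log (g * (a - 1) / (a + 1)) / 2

variable {a : ℝ}

lemma exp_two_mul_optExponent (hg : 0 < g) (ha : 1 < a) :
    Real.exp (2 * optExponent g a) = g * (a - 1) / (a + 1) := by
  have : 0 < a - 1 := by linarith
  rw [optExponent, mul_div_cancel₀ _ two_ne_zero, Real.exp_log (by positivity)]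

lemma optExponent_neg (hg : 1 < g) (ha : 1 < a) (ha' : a < biasedSlowness g) :
    optExponent g a < 0 := by
  have : 0 < a - 1 := by linarith
  rw [biasedSlowness, lt_div_iff₀ (by linarith)] at ha'
  refine div_neg_of_neg_of_pos (Real.log_neg (by positivity) ?_) two_pos
  rw [div_lt_one (by linarith)]
  linarith

lemma mul_logDiscount_sub_le (hg : 0 < g) (ha : 1 < a) (L : ℝ) :
    a * logDiscount g L - L ≤ a * logDiscount g (optExponent g a) - optExponent g a := by
  set M := optExponent g a
  set π := (a - 1) / (2 * a) with hπ
  have ha0 : 0 < a - 1 := by linarith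
  have π_nonneg : 0 ≤ π := by positivity
  have one_sub_π_nonneg : 0 ≤ 1 - π := by
    rw [hπ, sub_nonneg, div_le_one (by linarith)]
    linarith
  have convexity : Real.exp (π * (2 * (L - M))) ≤ (1 - π) + π * Real.exp (2 * (L - M)) := by
    simpa using convexOn_exp.2 (Set.mem_univ 0) (Set.mem_univ (2 * (L - M))) one_sub_π_nonneg
      π_nonneg (by ring)
  have average_eq : (1 - π) + π * Real.exp (2 * (L - M)) =
      (g + Real.exp (2 * L)) / (g + Real.exp (2 * M)) := by
    rw [mul_sub, Real.exp_sub, exp_two_mul_optExponent hg ha, hπ]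
    field_simp
    ring
  rw [average_eq, ← Real.le_log_iff_exp_le (by positivity),
    Real.log_div (by positivity) (by positivity)] at convexity
  have slope_eq : a * (π * (2 * (L - M))) = (a - 1) * (L - M) := by
    rw [hπ]
    field_simp
  have := mul_le_mul_of_nonneg_left convexity (show 0 ≤ a by linarith)
  unfold logDiscount
  linarith

lemma biasedRate_eq (hg : 1 < g) (ha : 1 < a) (ha' : a < biasedMean g hg) :
    biasedRate g hg a = a * logDiscount g (optExponent g a) - optExponent g a := by
  have hg0 : 0 < g := by linarith
  have nonneg : 0 ≤ a * logDiscount g (optExponent g a) - optExponent g a := by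
    simpa [logDiscount_zero] using mul_logDiscount_sub_le hg0 ha 0
  have sub_biasedLogMGF {L : ℝ} (hL : L < 0) :
      ((logDiscount g L * a : ℝ) : EReal) - biasedLogMGF g hg (logDiscount g L) =
        ((a * logDiscount g L - L : ℝ) : EReal) := by
    rw [biasedLogMGF_logDiscount hg hL, ← EReal.coe_sub, mul_comm]
  rw [biasedRate, ← EReal.toReal_coe (a * logDiscount g (optExponent g a) - optExponent g a)]
  congr 1
  refine le_antisymm (iSup_le fun l => ?_) ?_
  · rcases lt_or_ge l 0 with hl | hl
    · obtain ⟨L, hL, rfl⟩ := exists_logDiscount_eq hg hl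
      rw [sub_biasedLogMGF hL, EReal.coe_le_coe_iff]
      exact mul_logDiscount_sub_le hg0 ha L
    · refine (EReal.sub_le_sub le_rfl (mul_biasedMean_le_biasedLogMGF hg hl)).trans ?_
      rw [← EReal.coe_sub, EReal.coe_le_coe_iff]
      nlinarith
  · exact le_iSup_of_le _ (sub_biasedLogMGF
      (optExponent_neg hg ha (biasedMean_eq hg ▸ ha'))).ge

end Rate

section Binomial

lemma pow_mul_factorial_le (j i : ℕ) : j ^ i * j.factorial ≤ i.factorial * j ^ j := by
  rcases le_total j i with h | h
  · calc j ^ i * j.factorial = j.factorial * j ^ (i - j) * j ^ j := by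
          rw [mul_assoc, ← pow_add, Nat.sub_add_cancel h, mul_comm]
      _ ≤ i.factorial * j ^ j :=
          Nat.mul_le_mul_right _ (Nat.factorial_mul_pow_sub_le_factorial h)
  · calc j ^ i * j.factorial = j ^ i * ((j - (j - i)).factorial * j.descFactorial (j - i)) := by
          rw [Nat.factorial_mul_descFactorial (Nat.sub_le j i)]
      _ ≤ j ^ i * ((j - (j - i)).factorial * j ^ (j - i)) := by
          gcongr
          exact Nat.descFactorial_le_pow j (j - i)
      _ = i.factorial * j ^ j := by
          rw [Nat.sub_sub_self h, mul_left_comm, ← pow_add, Nat.add_sub_cancel' h]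

lemma pow_mul_pow_mul_choose_le {i j l : ℕ} (hi : i ≤ j + l) :
    j ^ i * l ^ (j + l - i) * (j + l).choose i ≤ j ^ j * l ^ l * (j + l).choose j := by
  refine Nat.le_of_mul_le_mul_right ?_ (Nat.mul_pos j.factorial_pos l.factorial_pos)
  have choose_j : (j + l).choose j * j.factorial * l.factorial = (j + l).factorial := by
    simpa using Nat.choose_mul_factorial_mul_factorial (Nat.le_add_right j l)
  calc j ^ i * l ^ (j + l - i) * (j + l).choose i * (j.factorial * l.factorial)
      = (j ^ i * j.factorial) * (l ^ (j + l - i) * l.factorial) * (j + l).choose i := by ring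
    _ ≤ (i.factorial * j ^ j) * ((j + l - i).factorial * l ^ l) * (j + l).choose i := by
        gcongr ?_ * ?_ * _ <;> exact pow_mul_factorial_le _ _
    _ = j ^ j * l ^ l * ((j + l).choose i * i.factorial * (j + l - i).factorial) := by ring
    _ = j ^ j * l ^ l * (j + l).choose j * (j.factorial * l.factorial) := by
        rw [Nat.choose_mul_factorial_mul_factorial hi, ← choose_j]
        ring

lemma add_pow_add_le (j l : ℕ) :
    (j + l) ^ (j + l) ≤ (j + l + 1) * (j ^ j * l ^ l * (j + l).choose j) := by
  rw [add_pow]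
  simpa using Finset.sum_le_card_nsmul (Finset.range (j + l + 1)) _ _ fun i hi =>
    pow_mul_pow_mul_choose_le (Nat.lt_succ_iff.1 (Finset.mem_range.1 hi))

/-- The probability of exactly `j` successes in `k` independent trials of success probability `p`;
it is `0` for `k < j`. -/
def binomialProb (p : ℝ) (k j : ℕ) : ℝ := k.choose j * (p ^ j * (1 - p) ^ (k - j))

/-- The exponent `E ≤ 0` for which the probability of `α n` successes and `β n` failures is
`exp (E n + o(n))`. -/
def binomialExponent (p α β : ℝ) : ℝ :=
  α * Real.log (p * (α + β) / α) + β * Real.log ((1 - p) * (α + β) / β)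

variable {p : ℝ}

lemma binomialProb_nonneg (hp : 0 ≤ p) (hp' : p ≤ 1) (k j : ℕ) : 0 ≤ binomialProb p k j := by
  have : 0 ≤ 1 - p := by linarith
  unfold binomialProb
  positivity

lemma binomialProb_pos (hp : 0 < p) (hp' : p < 1) {k j : ℕ} (hj : j ≤ k) :
    0 < binomialProb p k j := by
  have : 0 < 1 - p := by linarith
  have := Nat.choose_pos hj
  unfold binomialProb
  positivity

lemma binomialProb_succ (p : ℝ) (k j : ℕ) :
    binomialProb p (k + 1) (j + 1) =
      p * binomialProb p k j + (1 - p) * binomialProb p k (j + 1) := by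
  unfold binomialProb
  rw [Nat.choose_succ_succ, Nat.add_sub_add_right]
  rcases Nat.lt_or_ge k (j + 1) with h | h
  · rw [Nat.choose_eq_zero_of_lt h]
    push_cast
    ring
  · rw [show k - j = k - (j + 1) + 1 by omega]
    push_cast
    ring

lemma binomialProb_le_one (hp : 0 ≤ p) (hp' : p ≤ 1) (k j : ℕ) : binomialProb p k j ≤ 1 := by
  rcases Nat.lt_or_ge k j with h | h
  · simp [binomialProb, Nat.choose_eq_zero_of_lt h]
  · have sum_eq_one : ∑ i ∈ Finset.range (k + 1), binomialProb p k i = 1 := by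
      simpa [binomialProb, mul_comm] using (add_pow p (1 - p) k).symm
    rw [← sum_eq_one]
    exact Finset.single_le_sum (f := binomialProb p k)
      (fun i _ => binomialProb_nonneg hp hp' k i) (Finset.mem_range.2 (Nat.lt_succ_of_le h))

lemma binomialExponent_mul {c : ℝ} (hc : c ≠ 0) (p α β : ℝ) :
    binomialExponent p (α * c) (β * c) = binomialExponent p α β * c := by
  unfold binomialExponent
  rw [← add_mul, ← mul_assoc, ← mul_assoc, mul_div_mul_right _ _ hc, mul_div_mul_right _ _ hc]
  ring

lemma continuousAt_binomialExponent (hp : 0 < p) (hp' : p < 1) {α β : ℝ} (hα : 0 < α)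
    (hβ : 0 < β) :
    ContinuousAt (fun q : ℝ × ℝ => binomialExponent p q.1 q.2) (α, β) := by
  have : 0 < 1 - p := by linarith
  unfold binomialExponent
  fun_prop (disch := positivity)

lemma binomialExponent_sub_log_le (hp : 0 < p) (hp' : p < 1) {j l : ℕ} (hj : 0 < j) (hl : 0 < l) :
    binomialExponent p j l - Real.log (j + l + 1) ≤ Real.log (binomialProb p (j + l) j) := by
  have : 0 < 1 - p := by linarith
  have largest_term : (j + l : ℝ) ^ (j + l) ≤ (j + l + 1) * (j ^ j * l ^ l * (j + l).choose j) := by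
    exact_mod_cast add_pow_add_le j l
  rw [binomialExponent, ← Real.log_pow, ← Real.log_pow, ← Real.log_mul (by positivity)
    (by positivity), ← Real.log_div (by positivity) (by positivity)]
  refine Real.log_le_log (by positivity) ?_
  rw [div_le_iff₀ (by positivity)]
  calc (p * (j + l) / j) ^ j * ((1 - p) * (j + l) / l) ^ l
      = p ^ j * (1 - p) ^ l * (j + l : ℝ) ^ (j + l) / (j ^ j * l ^ l) := by
        rw [div_pow, div_pow, mul_pow, mul_pow, pow_add]
        field_simp
    _ ≤ p ^ j * (1 - p) ^ l * ((j + l + 1) * (j ^ j * l ^ l * (j + l).choose j)) /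
          (j ^ j * l ^ l) := by gcongr
    _ = binomialProb p (j + l) j * (j + l + 1) := by
        rw [binomialProb, Nat.add_sub_cancel_left]
        field_simp

variable {g : ℝ}

lemma binomialExponent_eq {a : ℝ} (hg : 0 < g) (ha : 1 < a) :
    binomialExponent (g / (g + 1)) ((a + 1) / 2) ((a - 1) / 2) =
      -(a * logDiscount g (optExponent g a) - optExponent g a) := by
  have : 0 < a - 1 := by linarith
  have success_eq : g / (g + 1) * ((a + 1) / 2 + (a - 1) / 2) / ((a + 1) / 2) =
      g * (2 * a) / ((g + 1) * (a + 1)) := by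
    field_simp
    ring
  have failure_eq : (1 - g / (g + 1)) * ((a + 1) / 2 + (a - 1) / 2) / ((a - 1) / 2) =
      2 * a / ((g + 1) * (a - 1)) := by
    field_simp
    ring
  have discount_eq : g + g * (a - 1) / (a + 1) = g * (2 * a) / (a + 1) := by
    field_simp
    ring
  rw [binomialExponent, success_eq, failure_eq, logDiscount, exp_two_mul_optExponent hg ha,
    discount_eq, optExponent]
  simp only [Real.log_div, Real.log_mul, ne_eq, mul_eq_zero, hg.ne', this.ne',
    (by positivity : g + 1 ≠ 0), (by positivity : a + 1 ≠ 0), (by positivity : a ≠ 0),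
    two_ne_zero, or_self, not_false_eq_true]
  ring

lemma binomialProb_le_line {V : Type*} (hg : 1 < g) (e : V ≃ ℤ) {N : ℤ} {x : V} (hx : e x < N)
    {k j : ℕ} (hj : e x + 2 * j - k = N) :
    ENNReal.ofReal (binomialProb (g / (g + 1)) k j) ≤
      ∑ i ∈ Finset.range k, ((biasedLine g hg).comap e).hitProb {e.symm N} i x := by
  have hp : 0 ≤ g / (g + 1) := by positivity
  have hp' : g / (g + 1) ≤ 1 := div_le_one_of_le₀ (by linarith) (by linarith)
  induction k generalizing x j with
  | zero =>
    obtain ⟨j, rfl⟩ : ∃ i, j = i + 1 := ⟨j - 1, by omega⟩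
    simp [binomialProb]
  | succ k ih =>
    obtain ⟨j, rfl⟩ : ∃ i, j = i + 1 := ⟨j - 1, by omega⟩
    set hit : ℤ → ℝ≥0∞ := fun y => if y = N then 1 else
      ∑ i ∈ Finset.range k, ((biasedLine g hg).comap e).hitProb {e.symm N} i (e.symm y) with hhit
    have le_hit {y : ℤ} {i : ℕ} (hy : y ≤ N) (hi : y + 2 * i - k = N) :
        ENNReal.ofReal (binomialProb (g / (g + 1)) k i) ≤ hit y := by
      rcases hy.eq_or_lt with rfl | hy
      · simpa [hhit] using binomialProb_le_one hp hp' k i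
      · simpa [hhit, hy.ne] using ih (x := e.symm y) (by simpa using hy) (by simpa using hi)
    have first_step := mul_enter_add_killed_line hg e (φ := hit) (N := N) (h := fun y =>
      ∑ i ∈ Finset.range k, ((biasedLine g hg).comap e).hitProb {e.symm N} i y)
      (fun y hy => by simp [hhit, hy.ne]) hx
    rw [show hit N = 1 by simp [hhit], one_mul] at first_step
    rw [sum_hitProb_succ, first_step, binomialProb_succ,
      ENNReal.ofReal_add (mul_nonneg hp (binomialProb_nonneg hp hp' _ _))
        (mul_nonneg (by linarith) (binomialProb_nonneg hp hp' _ _)), ENNReal.ofReal_mul hp,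
      ENNReal.ofReal_mul (by linarith)]
    push_cast at hj
    gcongr
    · exact le_hit (by omega) (by omega)
    · exact le_hit (by omega) (by push_cast; omega)

variable {C : ℝ} {n : ℕ}

lemma binomialProb_le_supProbHitLE (hC : 1 ≤ C) (hg : 1 < g) (hn : 1 ≤ n) {t : ℝ} {k j : ℕ}
    (hk : (k : ℝ) ≤ t) (hj : 2 * j = n + k) :
    ENNReal.ofReal (binomialProb (g / (g + 1)) k j) ≤ supProbHitLE.{u} C g n t := by
  have ht : 0 ≤ t := k.cast_nonneg.trans hk
  refine le_trans ?_ (probHitLE_line_le_supProbHitLE hC hg n t)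
  have origin_notMem : Equiv.ulift.{u}.symm (0 : ℤ) ∉ ({Equiv.ulift.symm (n : ℤ)} : Set _) := by
    rw [Set.mem_singleton_iff, EmbeddingLike.apply_eq_iff_eq]
    omega
  rw [probHitLE_eq _ origin_notMem ht]
  refine (binomialProb_le_line hg Equiv.ulift.{u} (N := n) (by simp; omega)
    (by simp; omega)).trans (Finset.sum_le_sum_of_subset ?_)
  exact Finset.range_subset_range.2 ((Nat.le_floor_iff ht).2 hk)

lemma supProbHitLE_pos (hC : 1 ≤ C) (hg : 1 < g) (n : ℕ) {t : ℝ} (ht : n ≤ t) :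
    0 < supProbHitLE.{u} C g n t := by
  rcases n.eq_zero_or_pos with rfl | hn
  · refine lt_of_lt_of_le ?_ (probHitLE_line_le_supProbHitLE hC hg 0 t)
    rw [probHitLE_of_mem _ (by simp) (by simpa using ht)]
    exact one_pos
  · refine lt_of_lt_of_le ?_ (binomialProb_le_supProbHitLE hC hg hn ht (two_mul n))
    exact ENNReal.ofReal_pos.2
      (binomialProb_pos (by positivity) ((div_lt_one (by linarith)).2 (by linarith)) le_rfl)

end Binomial

section Asymptotic

variable {C g : ℝ}

lemma exists_infMeanHit_eq (hC : 1 ≤ C) (hg : 1 < g) :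
    ∃ f : ℕ → ℝ, f =O[atTop] (fun _ : ℕ => (1 : ℝ)) ∧
      ∀ n : ℕ, ((infMeanHit.{u} C g n : ℝ≥0∞) : EReal) =
        ((biasedMean g hg * n + f n : ℝ) : EReal) := by
  have one_le := one_le_biasedSlowness hg
  have loss_nonneg := stepLoss_nonneg hC hg
  have ne_top (n : ℕ) : infMeanHit.{u} C g n ≠ ∞ :=
    ((infMeanHit_le hC hg n).trans_lt ENNReal.ofReal_lt_top).ne
  refine ⟨fun n => (infMeanHit.{u} C g n).toReal - biasedSlowness g * n, ?_, fun n => ?_⟩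
  · refine IsBigO.of_bound (biasedSlowness g * stepLoss C g) ?_
    filter_upwards [eventually_ge_atTop 2] with n hn
    have lower := (ENNReal.ofReal_le_iff_le_toReal (ne_top n)).1 (le_infMeanHit hC hg hn)
    have upper := ENNReal.toReal_le_of_le_ofReal (by positivity) (infMeanHit_le hC hg n)
    have : 0 ≤ biasedSlowness g * stepLoss C g := by positivity
    rw [norm_one, mul_one, Real.norm_eq_abs, abs_le]
    constructor <;> linarith
  · rw [biasedMean_eq, add_sub_cancel, EReal.coe_ennreal_toReal (ne_top n)]

variable {a : ℝ}

lemma supProbHitLE_ne_top (C g : ℝ) (n : ℕ) (t : ℝ) : supProbHitLE.{u} C g n t ≠ ∞ :=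
  ((supProbHitLE_le_one C g n t).trans_lt ENNReal.one_lt_top).ne

lemma toReal_supProbHitLE_pos (hC : 1 ≤ C) (hg : 1 < g) (ha : 1 ≤ a) (n : ℕ) :
    0 < (supProbHitLE.{u} C g n (a * n)).toReal :=
  ENNReal.toReal_pos (supProbHitLE_pos hC hg n (le_mul_of_one_le_left n.cast_nonneg ha)).ne'
    (supProbHitLE_ne_top C g n _)

lemma log_supProbHitLE_div_le (hC : 1 ≤ C) (hg : 1 < g) (ha : 1 ≤ a) {L : ℝ} (hL : L < 0) :
    ∀ᶠ n : ℕ in atTop, Real.log (supProbHitLE.{u} C g n (a * n)).toReal / n ≤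
      L - a * (logDiscount g L / (1 - stepLoss C g / n)) := by
  filter_upwards [eventually_ge_atTop 2, eventually_gt_atTop ⌈stepLoss C g⌉₊] with n hn hloss
  rw [div_le_iff₀ (by positivity), Real.log_le_iff_le_exp (toReal_supProbHitLE_pos hC hg ha n)]
  exact ENNReal.toReal_le_of_le_ofReal (Real.exp_pos _).le
    (supProbHitLE_le hC hg hn (Nat.lt_of_ceil_lt hloss) (by linarith) hL)

lemma tendsto_logDiscount_div (C g a L : ℝ) :
    Tendsto (fun n : ℕ => L - a * (logDiscount g L / (1 - stepLoss C g / n))) atTop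
      (nhds (L - a * logDiscount g L)) := by
  have loss_div : Tendsto (fun n : ℕ => stepLoss C g / n) atTop (nhds 0) :=
    tendsto_const_nhds.div_atTop tendsto_natCast_atTop_atTop
  simpa using (((tendsto_const_nhds (x := logDiscount g L)).div (loss_div.const_sub 1)
    (by simp)).const_mul a).const_sub L

lemma le_log_supProbHitLE_div (hC : 1 ≤ C) (hg : 1 < g) {n j : ℕ} (hj : n < j)
    (hle : (j : ℝ) ≤ (a + 1) / 2 * n) :
    binomialExponent (g / (g + 1)) (j / n) (j / n - 1) - Real.log ((a + 1) * n) / n ≤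
      Real.log (supProbHitLE.{u} C g n (a * n)).toReal / n := by
  have hp : 0 < g / (g + 1) := by positivity
  have hp' : g / (g + 1) < 1 := (div_lt_one (by linarith)).2 (by linarith)
  have hn : 0 < n := by
    rcases n.eq_zero_or_pos with rfl | hn
    · rw [Nat.cast_zero, mul_zero] at hle
      exact absurd hj (Nat.cast_nonpos.1 hle).not_gt
    · exact hn
  obtain ⟨l, rfl⟩ := Nat.exists_eq_add_of_le hj.le
  have hl : 0 < l := by omega
  have one_le_n : (1 : ℝ) ≤ n := mod_cast hn
  have time_le : ((n + l : ℕ) : ℝ) + l + 1 ≤ (a + 1) * n := by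
    push_cast at hle ⊢
    linarith
  have prob_le := (ENNReal.ofReal_le_iff_le_toReal (supProbHitLE_ne_top C g n _)).1 <|
    binomialProb_le_supProbHitLE.{u} hC hg hn (t := a * n) (k := n + l + l) (j := n + l)
      (by push_cast at hle ⊢; linarith) (by omega)
  have exponent_eq : binomialExponent (g / (g + 1)) ((n + l : ℕ) / n) ((n + l : ℕ) / n - 1) * n =
      binomialExponent (g / (g + 1)) (n + l : ℕ) l := by
    rw [← binomialExponent_mul (by positivity)]
    congr 1 <;> push_cast <;> field_simp
    ring
  rw [le_div_iff₀ (by positivity), sub_mul, div_mul_cancel₀ _ (by positivity), exponent_eq]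
  calc binomialExponent (g / (g + 1)) (n + l : ℕ) l - Real.log ((a + 1) * n)
      ≤ binomialExponent (g / (g + 1)) (n + l : ℕ) l - Real.log ((n + l : ℕ) + l + 1) :=
        sub_le_sub_left (Real.log_le_log (by positivity) time_le) _
    _ ≤ Real.log (binomialProb (g / (g + 1)) (n + l + l) (n + l)) :=
        binomialExponent_sub_log_le hp hp' (by omega) hl
    _ ≤ Real.log (supProbHitLE.{u} C g n (a * n)).toReal :=
        Real.log_le_log (binomialProb_pos hp hp' (Nat.le_add_right _ _)) prob_le

lemma tendsto_log_mul_div {c : ℝ} (hc : 0 < c) :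
    Tendsto (fun n : ℕ => Real.log (c * n) / n) atTop (nhds 0) := by
  have log_div_self : Tendsto (fun y : ℝ => c * (Real.log y / y)) atTop (nhds 0) := by
    simpa using Real.isLittleO_log_id_atTop.tendsto_div_nhds_zero.const_mul c
  refine (log_div_self.comp (tendsto_natCast_atTop_atTop.const_mul_atTop hc)).congr fun n => ?_
  rw [Function.comp_apply, mul_div_assoc', mul_div_mul_left _ _ hc.ne']

lemma tendsto_log_supProbHitLE_div (hC : 1 ≤ C) (hg : 1 < g) (ha : 1 < a)
    (ha' : a < biasedMean g hg) :
    Tendsto (fun n : ℕ => Real.log (supProbHitLE.{u} C g n (a * n)).toReal / n) atTop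
      (nhds (-biasedRate g hg a)) := by
  have hp : 0 < g / (g + 1) := by positivity
  have hp' : g / (g + 1) < 1 := (div_lt_one (by linarith)).2 (by linarith)
  have ratio_lim : Tendsto (fun n : ℕ => (⌊(a + 1) / 2 * n⌋₊ : ℝ) / n) atTop
      (nhds ((a + 1) / 2)) :=
    (tendsto_nat_floor_mul_div_atTop (by linarith)).comp tendsto_natCast_atTop_atTop
  have lower_lim := ((continuousAt_binomialExponent hp hp' (by linarith : 0 < (a + 1) / 2)
    (by linarith : 0 < (a + 1) / 2 - 1)).tendsto.comp
      (ratio_lim.prodMk_nhds (ratio_lim.sub_const 1))).sub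
        (tendsto_log_mul_div (by linarith : 0 < a + 1))
  have upper_lim := tendsto_logDiscount_div C g a (optExponent g a)
  rw [sub_zero, show (a + 1) / 2 - 1 = (a - 1) / 2 by ring, binomialExponent_eq (by linarith) ha,
    ← biasedRate_eq hg ha ha'] at lower_lim
  rw [← neg_sub, ← biasedRate_eq hg ha ha'] at upper_lim
  refine tendsto_of_tendsto_of_tendsto_of_le_of_le' lower_lim upper_lim ?_
    (log_supProbHitLE_div_le hC hg ha.le (optExponent_neg hg ha (biasedMean_eq hg ▸ ha')))
  filter_upwards [eventually_ge_atTop 1,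
    ratio_lim.eventually (lt_mem_nhds (by linarith : 1 < (a + 1) / 2))] with n hn ratio_gt
  rw [one_lt_div (by positivity), Nat.cast_lt] at ratio_gt
  exact le_log_supProbHitLE_div hC hg ratio_gt (Nat.floor_le (by positivity))

lemma exists_supProbHitLE_eq (hC : 1 ≤ C) (hg : 1 < g) (ha : 1 < a) (ha' : a < biasedMean g hg) :
    ∃ h : ℕ → ℝ, h =o[atTop] (fun n : ℕ => (n : ℝ)) ∧
      ∀ n : ℕ, supProbHitLE.{u} C g n (a * n) =
        ENNReal.ofReal (Real.exp (-biasedRate g hg a * n + h n)) := by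
  refine ⟨fun n => Real.log (supProbHitLE.{u} C g n (a * n)).toReal + biasedRate g hg a * n,
    ?_, fun n => ?_⟩
  · have n_ne_zero : ∀ᶠ n : ℕ in atTop, (n : ℝ) ≠ 0 :=
      (eventually_ne_atTop 0).mono fun n => Nat.cast_ne_zero.2
    rw [isLittleO_iff_tendsto' (n_ne_zero.mono fun n hn h => absurd h hn)]
    have shifted := (tendsto_log_supProbHitLE_div.{u} hC hg ha ha').add_const (biasedRate g hg a)
    rw [neg_add_cancel] at shifted
    refine shifted.congr' (n_ne_zero.mono fun n hn => ?_)
    simp only [add_div, mul_div_cancel_right₀ _ hn]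
  · rw [neg_mul, neg_add_cancel_comm_assoc, Real.exp_log (toReal_supProbHitLE_pos hC hg ha.le n),
      ENNReal.ofReal_toReal (supProbHitLE_ne_top C g n _)]

end Asymptotic

end WeightedGraph

end

theorem corollary3 (C g : ℝ) (hC : 1 < C) (hg : 1 < g) :
    (∃ f : ℕ → ℝ, f =O[atTop] (fun _ : ℕ => (1 : ℝ)) ∧
      ∀ n : ℕ, ((WeightedGraph.infMeanHit.{u} C g n : ℝ≥0∞) : EReal) =
        ((biasedMean g hg * n + f n : ℝ) : EReal)) ∧
    ∀ a : ℝ, 1 < a → a < biasedMean g hg →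
      ∃ h : ℕ → ℝ, h =o[atTop] (fun n : ℕ => (n : ℝ)) ∧
        ∀ n : ℕ, WeightedGraph.supProbHitLE.{u} C g n (a * n) =
          ENNReal.ofReal (Real.exp (-biasedRate g hg a * n + h n)) :=
  ⟨WeightedGraph.exists_infMeanHit_eq hC.le hg,
    fun _ ha ha' => WeightedGraph.exists_supProbHitLE_eq hC.le hg ha ha'⟩
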